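/- For integers $n\ge 1$ and $0<\varepsilon\le 1$ let $C^n(\varepsilon)\subseteq\mathbb R^n$ be the deformed cube $$C^n(\varepsilon)=\Big\{x\in\mathbb R^n:\ \varepsilon|x_k|\le \frac{2^{\binom k2}}{\varepsilon^{k-1}}-(-1)^k\sum_{j=1}^{k-1}\binom{k-2}{j-1}x_j\quad(1\le k\le n)\Big\},$$ and for $d\le n$ let $C_d^n=C_d^n(\varepsilon)\subseteq\mathbb R^d$ be its image under the projection to the last $d$ coordinates, $(x_1,\dots,x_n)\mapsto(x_{n-d+1},\dots,x_n)$. So if $n\ge d+1$, deleting the first coordinate is a projection $\mathbb R^{d+1}\to\mathbb R^d$ that maps $C_{d+1}^n$ onto $C_d^n$. The upper faces of $C_{d+1}^n$ are the faces having a normal vector that is positive in this deleted coordinate, where a vector is normal to a face if its linear functional attains its maximum over the polytope exactly on that face. A combinatorial cube is a polytope whose face poset is isomorphic to that of $[0,1]^k$ for some $k\ge 0$. A cubical $d$-polytope is a $d$-dimensional polytope all of whose proper faces are combinatorial cubes. A cubical subdivision of a cubical $d$-polytope $P\subseteq\mathbb R^d$ is a finite polytopal complex of combinatorial cubes with union $P$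 that does not subdivide the boundary, i.e. every proper face of $P$ is a cell. A cell is interior if it is not contained in $\partial P$. A cubical $d$-polytope is $k$-stacked if it has a cubical subdivision without interior $(d-k-1)$-faces. **Proposition.** Let $n\ge d\ge 2$. There is $\varepsilon_0>0$, depending only on $n$ and $d$, such that for all $0<\varepsilon<\varepsilon_0$: 1. if $n\ge d+1$, the images in $\mathbb R^d$ of the upper faces of $C_{d+1}^n(\varepsilon)$ form a cubical subdivision of $C_d^n(\varepsilon)$ that has no interior $r$-faces, where $r=\lfloor d/2\rfloor-1$; 2. $C_d^n(\varepsilon)$ is a cubical $d$-polytope and it is $\lfloor (d+1)/2\rfloor$-stacked. -/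

import Mathlib

section Polytopes

variable {E : Type*} [AddCommGroup E] [Module ℝ E] [TopologicalSpace E]

/-- A (nonempty) polytope: the convex hull of a finite nonempty set of points. -/
def IsPolytope (P : Set E) : Prop :=
  ∃ S : Set E, S.Finite ∧ S.Nonempty ∧ P = convexHull ℝ S

/-- The dimension of a nonempty convex set: the dimension of its affine span. -/
noncomputable def polyDim (P : Set E) : ℕ :=
  Module.finrank ℝ (vectorSpan ℝ P)

/-- The face poset of `P`, ordered by inclusion; it contains the empty face and `P` itself. -/
def FacePoset (P : Set E) : Type _ :=
  {F : Set E // IsExposed ℝ P F}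

instance (P : Set E) : PartialOrder (FacePoset P) :=
  inferInstanceAs (PartialOrder {F : Set E // IsExposed ℝ P F})

/-- `F` is a proper face of `P`: nonempty and different from `P`. -/
def IsProperFace (P F : Set E) : Prop :=
  IsExposed ℝ P F ∧ F.Nonempty ∧ F ≠ P

/-- A combinatorial cube: a polytope whose face poset is isomorphic to that of the standard
cube `[0,1]^k`, for some `k ≥ 0`. -/
def IsCombinatorialCube (P : Set E) : Prop :=
  IsPolytope P ∧
    ∃ k : ℕ, Nonempty (FacePoset P ≃o FacePoset (Set.Icc (0 : Fin k → ℝ) 1))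

/-- A cubical `d`-polytope: all its proper faces are combinatorial cubes. -/
def IsCubicalPolytope (d : ℕ) (P : Set E) : Prop :=
  IsPolytope P ∧ polyDim P = d ∧ ∀ F : Set E, IsProperFace P F → IsCombinatorialCube F

/-- A cubical complex: a finite family of combinatorial cubes, closed under taking (nonempty)
faces, any two of which intersect in a (possibly empty) common face. -/
structure IsCubicalComplex (B : Set (Set E)) : Prop where
  finite : B.Finite
  cube : ∀ F ∈ B, IsCombinatorialCube F
  face_mem : ∀ F ∈ B, ∀ G : Set E, IsExposed ℝ F G → G.Nonempty → G ∈ B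
  inter_face : ∀ F ∈ B, ∀ G ∈ B, IsExposed ℝ F (F ∩ G) ∧ IsExposed ℝ G (F ∩ G)

/-- A cubical subdivision of the polytope `P` (as a cubical polytope): a cubical complex with
union `P` which does not subdivide the boundary of `P`, that is, every proper face of `P` is
a cell. -/
structure IsCubicalSubdivision (B : Set (Set E)) (P : Set E) : Prop where
  complex : IsCubicalComplex B
  union : ⋃₀ B = P
  boundary : ∀ F : Set E, IsProperFace P F → F ∈ B

end Polytopes

/-- `F` is an interior cell of a subdivision of the full-dimensional polytope `P ⊆ ℝ^d`:
it is not contained in the boundary of `P`. -/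
def IsInteriorCell {d : ℕ} (P F : Set (Fin d → ℝ)) : Prop :=
  ¬ F ⊆ frontier P

/-- A cubical `d`-polytope `P ⊆ ℝ^d` is `k`-stacked if it has a cubical subdivision without
interior `(d - k - 1)`-faces. -/
def IsStacked {d : ℕ} (k : ℕ) (P : Set (Fin d → ℝ)) : Prop :=
  IsCubicalPolytope d P ∧
    ∃ B : Set (Set (Fin d → ℝ)), IsCubicalSubdivision B P ∧
      ∀ F ∈ B, (polyDim F : ℤ) = (d : ℤ) - k - 1 → ¬ IsInteriorCell P F

/-- The deformed cube `C^n(ε)`. In terms of the 1-based indices `k' = k + 1`, `j' = j + 1`, the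
`k'`-th condition reads
`ε |x_{k'}| ≤ 2 ^ (k' choose 2) / ε ^ (k' - 1) - (-1) ^ k' ∑_{j' < k'} (k' - 2 choose j' - 1) x_{j'}`
(for `k' = 1` the sum is empty). -/
def deformedCube (n : ℕ) (ε : ℝ) : Set (Fin n → ℝ) :=
  {x | ∀ k : Fin n,
    ε * |x k| ≤ 2 ^ (((k : ℕ) + 1).choose 2) / ε ^ (k : ℕ)
      - (-1) ^ ((k : ℕ) + 1) * ∑ j ∈ Finset.Iio k, (((k : ℕ) - 1).choose (j : ℕ) : ℝ) * x j}

/-- The projection `ℝ^n → ℝ^d` to the last `d` coordinates. -/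
def lastCoords {d n : ℕ} (h : d ≤ n) (x : Fin n → ℝ) : Fin d → ℝ :=
  fun i => x ⟨n - d + i, by omega⟩

/-- The polytope `C_d^n(ε)`: the projection of `C^n(ε)` to the last `d` coordinates. -/
def cubicalPoly {d n : ℕ} (h : d ≤ n) (ε : ℝ) : Set (Fin d → ℝ) :=
  lastCoords h '' deformedCube n ε

/-- The map `ℝ^{d+1} → ℝ^d` deleting the first coordinate; it maps `C_{d+1}^n(ε)` to
`C_d^n(ε)`, both being projections of `C^n(ε)` to its last coordinates. -/
def dropFirst {d : ℕ} (y : Fin (d + 1) → ℝ) : Fin d → ℝ :=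
  fun i => y i.succ

/-- `G` is an upper face of `P ⊆ ℝ^{d+1}` with respect to `dropFirst`: it has a normal vector
`c` (a vector whose linear functional attains its maximum over `P` exactly on `G`) which is
positive in the deleted coordinate. -/
def IsUpperFace {d : ℕ} (P G : Set (Fin (d + 1) → ℝ)) : Prop :=
  ∃ c : Fin (d + 1) → ℝ, 0 < c 0 ∧ G = {y ∈ P | ∀ z ∈ P, c ⬝ᵥ z ≤ c ⬝ᵥ y}

/-- The images under `dropFirst` of the upper faces of `P ⊆ ℝ^{d+1}`. -/
def upperProjection {d : ℕ} (P : Set (Fin (d + 1) → ℝ)) : Set (Set (Fin d → ℝ)) :=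
  {F | ∃ G : Set (Fin (d + 1) → ℝ), IsUpperFace P G ∧ F = dropFirst '' G}

/-! Write a facet normal of the deformed cube as a row `(k, s)` with `k` counted from 0, and let `m
= n - d`. The kernel of the projection consists of the vectors `u` supported on the first `m`
coordinates. For `k ≥ 1` such a row takes the value `±ε u_k + (-1)^(k+1) p(k-1)` on `u`, where `p(t)
= ∑ (t choose j) u_j` is a polynomial of degree less than `m`. Up to an error of order `ε`, the rows
are therefore evaluations of `p` at consecutive integers with alternating signs, as for cyclic
polytopes.

Three facts follow for small `ε`. The right-hand sides dominate the sums (`eventually_isTame`), so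
every choice of non-opposite facets is the exact set of tight inequalities at some point, and all
faces are combinatorial cubes. Any `m` rows of distinct index are independent on the kernel, because
`m` values determine `p` (`eventually_eq_zero_of_cubeRow_eq_zero`); hence projections are generic,
proper faces of the image are injective images of cube faces, and so are the upper cells. Finally,
the rows outside a set `Z` of at most `⌊d/2⌋ - 1` indices cannot all be negative at one kernel
vector (`eventually_not_cubeRow_neg`): a vanishing finite difference of `p(t) ∏ (t+1-z)^2`, `z ∈ Z`,
is a relation with nonnegative coefficients between the numbers `(-1)^t p(t)`.

A point of the polytope projects to the interior exactly when some kernel vector is negative on all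
rows tight there. A cell of dimension `r` comes from a face with at least `n - r` tight rows, so the
third fact puts every cell of dimension `⌊d/2⌋ - 1` into the boundary. That the upper cells form a
subdivision is the general theory of regular subdivisions under a generic projection
(`isCubicalSubdivision_upperCells`). -/

/-! ### Faces of polyhedra and sets of tight inequalities -/

section Polyhedra

open Set Filter Topology

variable {E : Type*} [NormedAddCommGroup E] [NormedSpace ℝ E] {ι : Type*}

/-- The polyhedron `{x | a i x ≤ b i for all i}`. -/
def polyhedron (a : ι → StrongDual ℝ E) (b : ι → ℝ) : Set E := {x | ∀ i, a i x ≤ b i}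

/-- The set of inequalities which hold with equality at `x`. -/
def tight (a : ι → StrongDual ℝ E) (b : ι → ℝ) (x : E) : Set ι := {i | a i x = b i}

/-- The face of the polyhedron on which the inequalities in `I` are equalities. -/
def tightFace (a : ι → StrongDual ℝ E) (b : ι → ℝ) (I : Set ι) : Set E :=
  {x | x ∈ polyhedron a b ∧ I ⊆ tight a b x}

variable {a : ι → StrongDual ℝ E} {b : ι → ℝ} {x y v : E} {I : Set ι}

theorem tightFace_empty : tightFace a b ∅ = polyhedron a b := by
  ext x; simp [tightFace]

theorem mem_tightFace_tight (hx : x ∈ polyhedron a b) : x ∈ tightFace a b (tight a b x) :=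
  ⟨hx, subset_rfl⟩

theorem isClosed_polyhedron : IsClosed (polyhedron a b) := by
  have : polyhedron a b = ⋂ i, {x | a i x ≤ b i} := by ext; simp [polyhedron]
  rw [this]
  exact isClosed_iInter fun i => isClosed_le (a i).continuous continuous_const

theorem convex_polyhedron : Convex ℝ (polyhedron a b) := by
  have : polyhedron a b = ⋂ i, {x | a i x ≤ b i} := by ext; simp [polyhedron]
  rw [this]
  exact convex_iInter fun i => convex_halfSpace_le (a i).toLinearMap.isLinear (b i)

theorem tightFace_eq_inter :
    tightFace a b I = polyhedron a b ∩ ⋂ i ∈ I, {x | a i x = b i} := by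
  ext x
  simp [tightFace, tight, subset_def]

theorem convex_tightFace : Convex ℝ (tightFace a b I) := by
  rw [tightFace_eq_inter]
  exact convex_polyhedron.inter
    (convex_iInter₂ fun i _ => convex_hyperplane (a i).toLinearMap.isLinear (b i))

theorem isClosed_tightFace : IsClosed (tightFace a b I) := by
  rw [tightFace_eq_inter]
  exact isClosed_polyhedron.inter
    (isClosed_biInter fun i _ => isClosed_eq (a i).continuous continuous_const)

theorem tightFace_subset : tightFace a b I ⊆ polyhedron a b := fun _ h => h.1

theorem isCompact_tightFace (hP : IsCompact (polyhedron a b)) : IsCompact (tightFace a b I) :=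
  hP.of_isClosed_subset isClosed_tightFace tightFace_subset

theorem eventually_lt_of_notMem_tight (hx : x ∈ polyhedron a b) {i : ι} (hi : i ∉ tight a b x)
    (v : E) : ∀ᶠ t in 𝓝[>] (0 : ℝ), a i (x + t • v) < b i := by
  have h : Tendsto (fun t : ℝ => a i (x + t • v)) (𝓝 0) (𝓝 (a i (x + (0 : ℝ) • v))) :=
    Continuous.tendsto (by fun_prop) 0
  refine (h.eventually (gt_mem_nhds ?_)).filter_mono nhdsWithin_le_nhds
  simpa using lt_of_le_of_ne (hx i) hi

theorem eventually_add_smul_mem [Finite ι] (hx : x ∈ polyhedron a b)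
    (hv : ∀ i ∈ tight a b x, a i v ≤ 0) : ∀ᶠ t in 𝓝[>] (0 : ℝ), x + t • v ∈ polyhedron a b := by
  refine eventually_all.2 fun i => ?_
  by_cases hi : i ∈ tight a b x
  · filter_upwards [self_mem_nhdsWithin] with t ht
    have h1 : a i x = b i := hi
    have h2 := mul_nonpos_of_nonneg_of_nonpos (le_of_lt ht) (hv i hi)
    simp only [map_add, map_smul, smul_eq_mul]
    linarith
  · exact (eventually_lt_of_notMem_tight hx hi v).mono fun t => le_of_lt

theorem eventually_add_smul_lt [Finite ι] (hx : x ∈ polyhedron a b)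
    (hv : ∀ i ∈ tight a b x, a i v < 0) :
    ∀ᶠ t in 𝓝[>] (0 : ℝ), ∀ i, a i (x + t • v) < b i := by
  refine eventually_all.2 fun i => ?_
  by_cases hi : i ∈ tight a b x
  · filter_upwards [self_mem_nhdsWithin] with t ht
    have h1 : a i x = b i := hi
    have h2 := mul_neg_of_pos_of_neg (show 0 < t from ht) (hv i hi)
    simp only [map_add, map_smul, smul_eq_mul]
    linarith
  · exact eventually_lt_of_notMem_tight hx hi v

theorem eventually_add_smul_mem_tightFace [Finite ι] (hx : x ∈ tightFace a b I)
    (hv : ∀ i ∈ tight a b x, a i v = 0) : ∀ᶠ t in 𝓝[>] (0 : ℝ), x + t • v ∈ tightFace a b I := by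
  filter_upwards [eventually_add_smul_mem hx.1 fun i hi => (hv i hi).le] with t ht
  refine ⟨ht, fun i hi => ?_⟩
  have h1 : a i x = b i := hx.2 hi
  simp [tight, hv i (hx.2 hi), h1]

theorem tight_convexComb (hx : x ∈ polyhedron a b) (hy : y ∈ polyhedron a b) :
    tight a b ((1 / 2 : ℝ) • x + (1 / 2 : ℝ) • y) = tight a b x ∩ tight a b y := by
  ext i
  have h1 := hx i
  have h2 := hy i
  simp only [tight, map_add, map_smul, smul_eq_mul, mem_ofPred_eq, mem_inter_iff]
  constructor
  · intro h; constructor <;> linarith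
  · rintro ⟨h, h'⟩; linarith

/-- A nonempty exposed face of a face is determined by the inequalities tight at a suitable one of
its points. -/
theorem IsExposed.exists_eq_tightFace [Finite ι] {G : Set E} (hG : IsExposed ℝ (tightFace a b I) G)
    (hne : G.Nonempty) : ∃ x ∈ G, G = tightFace a b (tight a b x) := by
  -- A point of `G` with fewest tight inequalities. The midpoint with another point of `G` has the
  -- intersection of both tight sets, so minimal cardinality implies minimality under inclusion.
  obtain ⟨x, hxG, hmin⟩ : ∃ x ∈ G, ∀ y ∈ G, tight a b x ⊆ tight a b y := by
    obtain ⟨x, hx, hm⟩ := Set.exists_min_image ((tight a b) '' G) Set.ncard (Set.toFinite _)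
      (hne.image _)
    obtain ⟨x, hx, rfl⟩ := hx
    refine ⟨x, hx, fun y hy => ?_⟩
    have hz := (hG.convex convex_tightFace) hx hy (show (0 : ℝ) ≤ 1 / 2 by norm_num)
      (show (0 : ℝ) ≤ 1 / 2 by norm_num) (by norm_num)
    have h1 := hm _ (mem_image_of_mem _ hz)
    rw [tight_convexComb (hG.subset hx).1 (hG.subset hy).1] at h1
    have := Set.eq_of_subset_of_ncard_le inter_subset_left h1 (Set.toFinite _)
    exact this ▸ inter_subset_right
  refine ⟨x, hxG, Subset.antisymm (fun y hy => ⟨(hG.subset hy).1, hmin y hy⟩) fun y hy => ?_⟩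
  obtain ⟨l, rfl⟩ := hG hne
  have hyF : y ∈ tightFace a b I := ⟨hy.1, hxG.1.2.trans hy.2⟩
  -- The segment from `y` to `x` can be prolonged beyond `x` inside the face; since `l` is maximal
  -- at `x`, it cannot be smaller at `y`.
  have hst := eventually_add_smul_mem_tightFace (v := x - y) hxG.1 fun i hi => by
    have h1 : a i x = b i := hi
    have h2 : a i y = b i := hy.2 hi
    simp [h1, h2]
  obtain ⟨t, ht, ht0⟩ := (hst.and self_mem_nhdsWithin).exists
  have h1 := hxG.2 _ ht
  simp only [map_add, map_smul, smul_eq_mul, map_sub] at h1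
  have h2 : l x ≤ l y := by
    have : (0 : ℝ) < t := ht0
    by_contra h
    push Not at h
    nlinarith
  exact ⟨hyF, fun z hz => (hxG.2 z hz).trans h2⟩

theorem isExposed_tightFace [Finite ι] (I : Set ι) :
    IsExposed ℝ (polyhedron a b) (tightFace a b I) := by
  have := Fintype.ofFinite ι
  classical
  rintro ⟨w, hw⟩
  refine ⟨∑ i ∈ I.toFinset, a i, ?_⟩
  have key : ∀ x ∈ polyhedron a b, (∑ i ∈ I.toFinset, a i) x ≤ ∑ i ∈ I.toFinset, b i := by
    intro x hx
    rw [_root_.sum_apply]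
    exact Finset.sum_le_sum fun i _ => hx i
  have heq : ∀ x ∈ tightFace a b I, (∑ i ∈ I.toFinset, a i) x = ∑ i ∈ I.toFinset, b i := by
    intro x hx
    rw [_root_.sum_apply]
    exact Finset.sum_congr rfl fun i hi => hx.2 (by simpa using hi)
  ext x
  refine ⟨fun hx => ⟨hx.1, fun y hy => (key y hy).trans (heq x hx).ge⟩, fun hx => ⟨hx.1, ?_⟩⟩
  have h1 := (heq w hw).ge.trans (hx.2 w hw.1)
  have h2 : ∑ i ∈ I.toFinset, a i x = ∑ i ∈ I.toFinset, b i := by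
    rw [← _root_.sum_apply]
    exact le_antisymm (key x hx.1) h1
  rw [Finset.sum_eq_sum_iff_of_le fun i _ => hx.1 i] at h2
  exact fun i hi => h2 i (by simpa using hi)

theorem isExposed_tightFace_of_le [Finite ι] {J : Set ι} (h : tightFace a b J ⊆ tightFace a b I) :
    IsExposed ℝ (tightFace a b I) (tightFace a b J) :=
  (isExposed_tightFace J).mono tightFace_subset h

theorem IsExposed.trans_tightFace [Finite ι] {G : Set E}
    (hG : IsExposed ℝ (tightFace a b I) G) : IsExposed ℝ (polyhedron a b) G := by
  rcases G.eq_empty_or_nonempty with rfl | hne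
  · exact isExposed_empty
  obtain ⟨x, -, rfl⟩ := hG.exists_eq_tightFace hne
  exact isExposed_tightFace _

theorem finite_setOf_isExposed [Finite ι] : {G : Set E | IsExposed ℝ (polyhedron a b) G}.Finite := by
  refine ((Set.finite_range (tightFace a b)).union (Set.finite_singleton ∅)).subset fun G hG => ?_
  rcases G.eq_empty_or_nonempty with rfl | hne
  · exact Or.inr rfl
  rw [mem_ofPred_eq, ← tightFace_empty] at hG
  obtain ⟨x, -, h⟩ := hG.exists_eq_tightFace hne
  exact Or.inl ⟨_, h.symm⟩

theorem isPolytope_tightFace [Finite ι] (hP : IsCompact (polyhedron a b))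
    (hne : (tightFace a b I).Nonempty) : IsPolytope (tightFace a b I) := by
  have hc : IsCompact (tightFace a b I) := isCompact_tightFace hP
  -- Extreme points are finite in number because their tight sets distinguish them: if `y` has the
  -- same tight set as `x`, then `x` lies strictly between `y` and `x + t(x - y)`.
  have hinj : InjOn (tight a b) (extremePoints ℝ (tightFace a b I)) := by
    intro x hx y hy hxy
    have hst := eventually_add_smul_mem_tightFace (v := x - y) hx.1 fun i hi => by
      have h1 : a i x = b i := hi
      have h2 : a i y = b i := by rw [hxy] at hi; exact hi
      simp [h1, h2]
    obtain ⟨t, ht, ht0⟩ := (hst.and self_mem_nhdsWithin).exists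
    have ht0 : (0 : ℝ) < t := ht0
    have := (mem_extremePoints.1 hx).2 y hy.1 _ ht
      ⟨t / (1 + t), 1 / (1 + t), by positivity, by positivity, by field_simp; ring, ?_⟩
    · exact this.1.symm
    · have h3 : (1 + t) ≠ 0 := by positivity
      have h4 : t / (1 + t) - 1 / (1 + t) * t = 0 := by field_simp; ring
      have h5 : 1 / (1 + t) + 1 / (1 + t) * t = 1 := by field_simp
      calc _ = (t / (1 + t) - 1 / (1 + t) * t) • y + (1 / (1 + t) + 1 / (1 + t) * t) • x := by
            module
        _ = x := by rw [h4, h5]; simp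
  have hfin : (extremePoints ℝ (tightFace a b I)).Finite :=
    Set.Finite.of_finite_image (Set.toFinite _) hinj
  refine ⟨_, hfin, hc.extremePoints_nonempty hne, ?_⟩
  conv_lhs => rw [← closure_convexHull_extremePoints hc convex_tightFace]
  exact ((hfin.isCompact_convexHull (𝕜 := ℝ)).isClosed).closure_eq

end Polyhedra

/-! ### Isomorphisms of face posets and injective projections of faces -/

section FaceIso

open Set Filter Topology

variable {E E' : Type*} [NormedAddCommGroup E] [NormedSpace ℝ E] [NormedAddCommGroup E']
  [NormedSpace ℝ E'] {ι : Type*}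

theorem nonempty_facePoset_orderIso {P : Set E} {Q : Set E'} (f : Set E → Set E')
    (g : Set E' → Set E) (hf : ∀ G, IsExposed ℝ P G → IsExposed ℝ Q (f G))
    (hg : ∀ G, IsExposed ℝ Q G → IsExposed ℝ P (g G)) (mf : Monotone f) (mg : Monotone g)
    (hgf : ∀ G, IsExposed ℝ P G → g (f G) = G) (hfg : ∀ G, IsExposed ℝ Q G → f (g G) = G) :
    Nonempty (FacePoset P ≃o FacePoset Q) := by
  let e : FacePoset P ≃ FacePoset Q :=
    { toFun := fun G => Subtype.mk (f G.1) (hf G.1 G.2)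
      invFun := fun G => Subtype.mk (g G.1) (hg G.1 G.2)
      left_inv := fun G => Subtype.ext (hgf G.1 G.2)
      right_inv := fun G => Subtype.ext (hfg G.1 G.2) }
  exact ⟨e.toOrderIso (fun G H h => mf (show G.1 ≤ H.1 from h))
    (fun G H h => mg (show G.1 ≤ H.1 from h))⟩

/-- The faces of `tightFace a' b' I'` and of `tightFace a b I` correspond to each other by means of
the sets of tight inequalities. -/
def transportFace (a : ι → StrongDual ℝ E) (b : ι → ℝ) (a' : ι → StrongDual ℝ E') (b' : ι → ℝ)
    (I' : Set ι) (G : Set E) : Set E' :=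
  {y | y ∈ tightFace a' b' I' ∧ ∃ x ∈ G, tight a b x ⊆ tight a' b' y}

variable {a : ι → StrongDual ℝ E} {b : ι → ℝ} {a' : ι → StrongDual ℝ E'} {b' : ι → ℝ}
  {I I' : Set ι}

theorem monotone_transportFace : Monotone (transportFace a b a' b' I') :=
  fun _ _ h _ hy => ⟨hy.1, hy.2.imp fun _ hx => ⟨h hx.1, hx.2⟩⟩

theorem transportFace_tightFace {x : E} {y : E'} (hx : x ∈ polyhedron a b)
    (hy : y ∈ tightFace a' b' I') (h : tight a b x = tight a' b' y) :
    transportFace a b a' b' I' (tightFace a b (tight a b x)) =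
      tightFace a' b' (tight a' b' y) := by
  ext z
  constructor
  · rintro ⟨hz, w, hw, hwz⟩
    exact ⟨hz.1, h ▸ hw.2.trans hwz⟩
  · intro hz
    exact ⟨⟨hz.1, hy.2.trans hz.2⟩, x, mem_tightFace_tight hx, h ▸ hz.2⟩

theorem transportFace_empty : transportFace a b a' b' I' (∅ : Set E) = ∅ := by
  simp [transportFace]

theorem isExposed_transportFace [Finite ι]
    (h : ∀ x ∈ tightFace a b I, ∃ y ∈ tightFace a' b' I', tight a b x = tight a' b' y) {G : Set E}
    (hG : IsExposed ℝ (tightFace a b I) G) :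
    IsExposed ℝ (tightFace a' b' I') (transportFace a b a' b' I' G) := by
  rcases G.eq_empty_or_nonempty with rfl | hne
  · rw [transportFace_empty]; exact isExposed_empty
  obtain ⟨x, hxG, rfl⟩ := hG.exists_eq_tightFace hne
  obtain ⟨y, hy, hxy⟩ := h x (hG.subset hxG)
  rw [transportFace_tightFace hxG.1 hy hxy]
  exact isExposed_tightFace_of_le fun z hz => ⟨hz.1, hy.2.trans hz.2⟩

theorem transportFace_transportFace [Finite ι]
    (h : ∀ x ∈ tightFace a b I, ∃ y ∈ tightFace a' b' I', tight a b x = tight a' b' y) {G : Set E}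
    (hG : IsExposed ℝ (tightFace a b I) G) :
    transportFace a' b' a b I (transportFace a b a' b' I' G) = G := by
  rcases G.eq_empty_or_nonempty with rfl | hne
  · rw [transportFace_empty, transportFace_empty]
  obtain ⟨x, hxG, rfl⟩ := hG.exists_eq_tightFace hne
  obtain ⟨y, hy, hxy⟩ := h x (hG.subset hxG)
  rw [transportFace_tightFace hxG.1 hy hxy,
    transportFace_tightFace hy.1 (hG.subset hxG) hxy.symm]

/-- Every nonempty face is the tight face of one of its points, so the face poset depends only on
which index sets occur as tight sets. No linear map between the two polyhedra is needed. -/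
theorem nonempty_facePoset_tightFace_orderIso [Finite ι]
    (h : ∀ x ∈ tightFace a b I, ∃ y ∈ tightFace a' b' I', tight a b x = tight a' b' y)
    (h' : ∀ y ∈ tightFace a' b' I', ∃ x ∈ tightFace a b I, tight a' b' y = tight a b x) :
    Nonempty (FacePoset (tightFace a b I) ≃o FacePoset (tightFace a' b' I')) :=
  nonempty_facePoset_orderIso (transportFace a b a' b' I') (transportFace a' b' a b I)
    (fun _ => isExposed_transportFace h) (fun _ => isExposed_transportFace h')
    monotone_transportFace monotone_transportFace (fun _ => transportFace_transportFace h)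
    (fun _ => transportFace_transportFace h')

theorem IsExposed.image_of_section {P G : Set E} (hG : IsExposed ℝ P G) (f : E →L[ℝ] E')
    (g : E' →L[ℝ] E) (c : E) (hg : ∀ x ∈ P, g (f x) + c = x) : IsExposed ℝ (f '' P) (f '' G) := by
  rintro ⟨-, w, hw, rfl⟩
  obtain ⟨l, rfl⟩ := hG ⟨w, hw⟩
  have key : ∀ x ∈ P, l (g (f x)) = l x - l c := fun x hx => by
    conv_rhs => rw [← hg x hx]
    simp
  refine ⟨l.comp g, Subset.antisymm ?_ ?_⟩
  · rintro _ ⟨x, hx, rfl⟩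
    refine ⟨mem_image_of_mem _ hx.1, ?_⟩
    rintro _ ⟨y, hy, rfl⟩
    have := hx.2 y hy
    simp only [ContinuousLinearMap.comp_apply, key x hx.1, key y hy]
    linarith
  · rintro _ ⟨⟨x, hx, rfl⟩, hm⟩
    refine ⟨x, ⟨hx, fun y hy => ?_⟩, rfl⟩
    have := hm _ (mem_image_of_mem _ hy)
    simp only [ContinuousLinearMap.comp_apply, key x hx, key y hy] at this
    linarith

theorem IsExposed.inter_preimage {P : Set E} {f : E →L[ℝ] E'} {G : Set E'}
    (hG : IsExposed ℝ (f '' P) G) : IsExposed ℝ P (P ∩ f ⁻¹' G) := by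
  rintro ⟨w, hw, hwG⟩
  obtain ⟨l, rfl⟩ := hG ⟨_, hwG⟩
  refine ⟨l.comp f, ?_⟩
  ext x
  constructor
  · rintro ⟨hx, -, h⟩
    exact ⟨hx, fun y hy => h _ (mem_image_of_mem _ hy)⟩
  · rintro ⟨hx, h⟩
    refine ⟨hx, mem_image_of_mem _ hx, ?_⟩
    rintro _ ⟨y, hy, rfl⟩
    exact h y hy

theorem image_inter_preimage_of_subset {P : Set E} {f : E →L[ℝ] E'} {G : Set E'}
    (hG : G ⊆ f '' P) : f '' (P ∩ f ⁻¹' G) = G := by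
  rw [image_inter_preimage, inter_eq_right.2 hG]

theorem nonempty_facePoset_image_orderIso {P : Set E} (f : E →L[ℝ] E') (g : E' →L[ℝ] E) (c : E)
    (hg : ∀ x ∈ P, g (f x) + c = x) : Nonempty (FacePoset P ≃o FacePoset (f '' P)) := by
  refine nonempty_facePoset_orderIso (fun G => f '' G) (fun G => P ∩ f ⁻¹' G)
    (fun G hG => hG.image_of_section f g c hg) (fun G hG => hG.inter_preimage)
    (fun _ _ h => image_mono h) (fun _ _ h => inter_subset_inter_right _ (preimage_mono h))
    (fun G hG => ?_) (fun G hG => image_inter_preimage_of_subset hG.subset)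
  ext x
  constructor
  · rintro ⟨hx, y, hy, hyx⟩
    rw [← hg x hx, ← hyx, hg y (hG.subset hy)]
    exact hy
  · exact fun hx => ⟨hG.subset hx, mem_image_of_mem _ hx⟩

theorem IsPolytope.image {P : Set E} (hP : IsPolytope P) (f : E →L[ℝ] E') :
    IsPolytope (f '' P) := by
  obtain ⟨S, hS, hne, rfl⟩ := hP
  exact ⟨f '' S, hS.image _, hne.image _, f.toLinearMap.image_convexHull S⟩

theorem IsCombinatorialCube.image {P : Set E} (hP : IsCombinatorialCube P) (f : E →L[ℝ] E')
    (g : E' →L[ℝ] E) (c : E) (hg : ∀ x ∈ P, g (f x) + c = x) : IsCombinatorialCube (f '' P) := by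
  obtain ⟨h1, k, ⟨e⟩⟩ := hP
  obtain ⟨e'⟩ := nonempty_facePoset_image_orderIso f g c hg
  exact ⟨h1.image f, k, ⟨e'.symm.trans e⟩⟩

/-- The directions in which all inequalities tight at `x` stay tight. -/
def tightDirection (a : ι → StrongDual ℝ E) (b : ι → ℝ) (x : E) : Submodule ℝ E :=
  ⨅ i ∈ tight a b x, LinearMap.ker (a i).toLinearMap

theorem mem_tightDirection {x v : E} :
    v ∈ tightDirection a b x ↔ ∀ i ∈ tight a b x, a i v = 0 := by
  simp [tightDirection]

/-- The differences of points of the face are tight directions, on which `f` is injective; a linear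
left inverse there gives an affine inverse of `f` on the face. -/
theorem exists_section_tightFace [FiniteDimensional ℝ E'] {x : E} (f : E →L[ℝ] E')
    (hinj : ∀ u, f u = 0 → (∀ i ∈ tight a b x, a i u = 0) → u = 0) :
    ∃ (g : E' →L[ℝ] E) (c : E), ∀ y ∈ tightFace a b (tight a b x), g (f y) + c = y := by
  obtain ⟨g, hg⟩ := (f.toLinearMap.domRestrict (tightDirection a b x)).exists_leftInverse_of_injective
    (LinearMap.ker_eq_bot'.2 fun u hu => Subtype.ext (hinj u.1 hu (mem_tightDirection.1 u.2)))
  refine ⟨((tightDirection a b x).subtype ∘ₗ g).toContinuousLinearMap, x - g (f x), fun y hy => ?_⟩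
  have hyx : y - x ∈ tightDirection a b x := mem_tightDirection.2 fun i hi => by
    have h1 : a i x = b i := hi
    have h2 : a i y = b i := hy.2 hi
    simp [h1, h2]
  have h := LinearMap.congr_fun hg ⟨y - x, hyx⟩
  have h3 : g (f (y - x)) = (⟨y - x, hyx⟩ : tightDirection a b x) := h
  have h4 : ((g (f y) : E)) - g (f x) = y - x := by
    rw [map_sub, map_sub] at h3
    exact congrArg Subtype.val h3
  calc _ = ((g (f y) : E) - g (f x)) + x := by simp; abel
    _ = y := by rw [h4]; abel

/-- Rank-nullity: each tight inequality lowers the dimension of the space of tight directions by at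
most one, and `f` preserves that dimension. A short move along any tight direction stays in the
face. -/
theorem finrank_le_polyDim_add_ncard [Finite ι] [FiniteDimensional ℝ E] [FiniteDimensional ℝ E']
    {x : E} (hx : x ∈ polyhedron a b) (f : E →L[ℝ] E')
    (hinj : ∀ u, f u = 0 → (∀ i ∈ tight a b x, a i u = 0) → u = 0) :
    Module.finrank ℝ E ≤
      polyDim (f '' tightFace a b (tight a b x)) + (tight a b x).ncard := by
  have := Fintype.ofFinite (tight a b x)
  let A : E →ₗ[ℝ] (tight a b x → ℝ) := LinearMap.pi fun i => (a i).toLinearMap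
  have hker : LinearMap.ker A = tightDirection a b x := by
    ext v
    simp [A, mem_tightDirection, funext_iff]
  have h1 := LinearMap.finrank_range_add_finrank_ker A
  have h2 : Module.finrank ℝ (LinearMap.range A) ≤ (tight a b x).ncard := by
    refine (Submodule.finrank_le _).trans ?_
    rw [Module.finrank_fintype_fun_eq_card, ← Nat.card_eq_fintype_card, Nat.card_coe_set_eq]
  have h3 : (tightDirection a b x).map f.toLinearMap ≤
      vectorSpan ℝ (f '' tightFace a b (tight a b x)) := by
    rintro _ ⟨v, hv, rfl⟩
    have hst := eventually_add_smul_mem_tightFace (v := v) (mem_tightFace_tight hx)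
      (mem_tightDirection.1 hv)
    obtain ⟨t, ht, ht0⟩ := (hst.and self_mem_nhdsWithin).exists
    have ht0 : t ≠ 0 := ne_of_gt ht0
    have h := vsub_mem_vectorSpan ℝ (mem_image_of_mem f ht)
      (mem_image_of_mem f (mem_tightFace_tight hx))
    have h5 := Submodule.smul_mem _ t⁻¹ h
    simpa [smul_smul, ht0] using h5
  have h4 : Module.finrank ℝ ((tightDirection a b x).map f.toLinearMap) =
      Module.finrank ℝ (tightDirection a b x) := by
    have hi : Function.Injective (f.toLinearMap.domRestrict (tightDirection a b x)) :=
      LinearMap.ker_eq_bot.1 (LinearMap.ker_eq_bot'.2 fun u hu =>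
        Subtype.ext (hinj u.1 hu (mem_tightDirection.1 u.2)))
    rw [← LinearMap.range_domRestrict]
    exact LinearMap.finrank_range_of_inj hi
  have h5 := Submodule.finrank_mono h3
  rw [hker] at h1
  unfold polyDim
  omega

/-- It suffices to check finitely many generators. Those with `f x = M` satisfy the bound for every
`δ ≥ 0`, the others have slack for small `δ`. -/
theorem exists_forall_add_smul_le {P : Set E} (hP : IsPolytope P) (f k : StrongDual ℝ E)
    (M c : ℝ) (hf : ∀ x ∈ P, f x ≤ M) (hk : ∀ x ∈ P, f x = M → k x ≤ c) :
    ∃ δ > 0, ∀ x ∈ P, f x + δ * k x ≤ M + δ * c := by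
  obtain ⟨S, hS, -, rfl⟩ := hP
  have hev : ∀ᶠ δ in 𝓝[>] (0 : ℝ), ∀ x ∈ S, f x + δ * k x ≤ M + δ * c := by
    refine (Filter.eventually_all_finite hS).2 fun x hx => ?_
    have hxS := subset_convexHull ℝ S hx
    rcases (hf x hxS).eq_or_lt with h | h
    · filter_upwards [self_mem_nhdsWithin] with δ hδ
      have := mul_le_mul_of_nonneg_left (hk x hxS h) (le_of_lt hδ)
      linarith
    · have ht : Tendsto (fun δ : ℝ => f x + δ * k x - (M + δ * c)) (𝓝 0)
          (𝓝 (f x + 0 * k x - (M + 0 * c))) := Continuous.tendsto (by fun_prop) 0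
      have := (ht.eventually (gt_mem_nhds (show _ < (0 : ℝ) by linarith))).filter_mono
        (nhdsWithin_le_nhds (s := Ioi 0))
      filter_upwards [this] with δ hδ
      linarith
  obtain ⟨δ, hδ, hδ0⟩ := (hev.and self_mem_nhdsWithin).exists
  refine ⟨δ, hδ0, fun x hx => ?_⟩
  have hcv : Convex ℝ {x : E | (f + δ • k) x ≤ M + δ * c} :=
    convex_halfSpace_le (f + δ • k).toLinearMap.isLinear _
  exact convexHull_min (fun y hy => by simpa using hδ y hy) hcv hx |> fun h => by simpa using h

end FaceIso

/-! ### Generic projections and the subdivision by upper cells -/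

section UpperCells

open Set Filter Topology

variable {E E' : Type*} [NormedAddCommGroup E] [NormedSpace ℝ E] [NormedAddCommGroup E']
  [NormedSpace ℝ E'] {ι : Type*}

theorem IsPolytope.isCompact {P : Set E} (hP : IsPolytope P) : IsCompact P := by
  obtain ⟨S, hS, -, rfl⟩ := hP
  exact hS.isCompact_convexHull (𝕜 := ℝ)

theorem IsPolytope.nonempty {P : Set E} (hP : IsPolytope P) : P.Nonempty := by
  obtain ⟨S, hS, hne, rfl⟩ := hP
  exact hne.convexHull

theorem toExposed_nonempty {P : Set E} (hP : IsCompact P) (hne : P.Nonempty)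
    (f : StrongDual ℝ E) : (f.toExposed P).Nonempty := by
  obtain ⟨x, hx, h⟩ := hP.exists_isMaxOn hne f.continuous.continuousOn
  exact ⟨x, hx, fun y hy => h hy⟩

theorem toExposed_smul {P : Set E} {f : StrongDual ℝ E} {δ : ℝ} (hδ : 0 < δ) :
    (δ • f).toExposed P = f.toExposed P := by
  ext x
  simp [ContinuousLinearMap.toExposed, mul_le_mul_iff_right₀ hδ]

/-- A face of a face is a face, with control over the exposing functional: a small perturbation by
`k` breaks ties among the maximizers of `f`. -/
theorem exists_toExposed_add_smul {P : Set E} (hP : IsPolytope P) (f k : StrongDual ℝ E) :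
    ∃ δ > (0 : ℝ), (f + δ • k).toExposed P = k.toExposed (f.toExposed P) := by
  have hG : IsExposed ℝ P (f.toExposed P) := ContinuousLinearMap.toExposed.isExposed
  obtain ⟨x, hx⟩ := toExposed_nonempty (hG.isCompact hP.isCompact)
    (toExposed_nonempty hP.isCompact hP.nonempty f) k
  obtain ⟨δ, hδ, h⟩ := exists_forall_add_smul_le hP f k (f x) (k x) (fun y hy => hx.1.2 y hy)
    fun y hy hyx => hx.2 y ⟨hy, fun z hz => (hx.1.2 z hz).trans hyx.ge⟩
  -- The bound holds for `δ`; halving it leaves a margin that forces a maximizer of `f + (δ / 2) •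
  -- k` to maximize `f`.
  refine ⟨δ / 2, by positivity, Subset.antisymm (fun y hy => ?_) fun y hy => ⟨hy.1.1, ?_⟩⟩
  · have h1 := hy.2 x hx.1.1
    have h2 := h y hy.1
    have h3 := hx.1.2 y hy.1
    simp only [_root_.add_apply, _root_.smul_apply, smul_eq_mul] at h1
    have h4 : f y = f x := by linarith
    have h5 : k x ≤ k y := by
      by_contra hc
      push Not at hc
      nlinarith
    exact ⟨⟨hy.1, fun z hz => (hx.1.2 z hz).trans h4.ge⟩, fun z hz => (hx.2 z hz).trans h5⟩
  · intro z hz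
    have h1 := hy.2 x hx.1
    have h2 := h z hz
    have h3 := hx.1.2 z hz
    have h4 := hy.1.2 x hx.1.1
    have h5 := mul_le_mul_of_nonneg_left h1 hδ.le
    simp only [_root_.add_apply, _root_.smul_apply, smul_eq_mul]
    linarith

theorem IsProperFace.subset_frontier {P F : Set E} (h : IsProperFace P F) : F ⊆ frontier P := by
  intro x hx
  refine ⟨subset_closure (h.1.subset hx), fun hint => h.2.2 ?_⟩
  obtain ⟨l, rfl⟩ := h.1 h.2.1
  have key : ∀ v, l v ≤ 0 := by
    intro v
    have ht : Tendsto (fun t : ℝ => x + t • v) (𝓝 0) (𝓝 (x + (0 : ℝ) • v)) :=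
      Continuous.tendsto (by fun_prop) 0
    rw [zero_smul, add_zero] at ht
    have hev := (ht.eventually (isOpen_interior.mem_nhds hint)).filter_mono
        (nhdsWithin_le_nhds (s := Ioi 0))
    obtain ⟨t, ht, ht0⟩ := (hev.and self_mem_nhdsWithin).exists
    have := hx.2 _ (interior_subset ht)
    simp only [map_add, map_smul, smul_eq_mul] at this
    have ht0 : (0 : ℝ) < t := ht0
    by_contra hc
    push Not at hc
    nlinarith [mul_pos ht0 hc]
  refine Subset.antisymm (fun y hy => hy.1) fun y hy => ⟨hy, fun z hz => ?_⟩
  have := key (z - y)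
  rw [map_sub] at this
  linarith

variable {a : ι → StrongDual ℝ E} {b : ι → ℝ}

/-- A short move along `u` enters the open polyhedron without changing the image, and a surjective
`f` is open. -/
theorem mem_interior_image_of_exists [Finite ι] [FiniteDimensional ℝ E] [FiniteDimensional ℝ E']
    {f : E →L[ℝ] E'} (hf : Function.Surjective f) {x u : E} (hx : x ∈ polyhedron a b)
    (hu : f u = 0) (hxu : ∀ i ∈ tight a b x, a i u < 0) : f x ∈ interior (f '' polyhedron a b) := by
  obtain ⟨t, ht⟩ := (eventually_add_smul_lt hx hxu).exists
  have hfo : IsOpenMap f := by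
    have := FiniteDimensional.complete ℝ E
    have := FiniteDimensional.complete ℝ E'
    exact f.isOpenMap hf
  have ho : IsOpen {x | ∀ i, a i x < b i} := by
    rw [ofPred_forall]
    exact isOpen_iInter_of_finite fun i => isOpen_lt (a i).continuous continuous_const
  refine interior_maximal (image_mono fun y hy i => (hy i).le) (hfo _ ho) ⟨x + t • u, ht, ?_⟩
  simp [hu]

/-- Prolong the segment from `f z` through `f x` to a point `f w` of the image. The kernel vector `w
+ t z - (1 + t) x` works, since `z` satisfies all inequalities strictly. -/
theorem exists_of_mem_interior_image {f : E →L[ℝ] E'} {x z : E}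
    (hz : ∀ i, a i z < b i) (hint : f x ∈ interior (f '' polyhedron a b)) :
    ∃ u, f u = 0 ∧ ∀ i ∈ tight a b x, a i u < 0 := by
  have ht : Tendsto (fun t : ℝ => f x + t • (f x - f z)) (𝓝 0)
      (𝓝 (f x + (0 : ℝ) • (f x - f z))) := Continuous.tendsto (by fun_prop) 0
  rw [zero_smul, add_zero] at ht
  have hev := (ht.eventually (isOpen_interior.mem_nhds hint)).filter_mono
    (nhdsWithin_le_nhds (s := Ioi 0))
  obtain ⟨t, ht, ht0⟩ := (hev.and self_mem_nhdsWithin).exists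
  have ht0 : (0 : ℝ) < t := ht0
  obtain ⟨w, hw, hwx⟩ := interior_subset ht
  refine ⟨w + t • z - (1 + t) • x, ?_, fun i hi => ?_⟩
  · simp only [map_sub, map_add, map_smul, hwx]
    module
  · have h1 : a i x = b i := hi
    have h2 := hw i
    have h3 := mul_lt_mul_of_pos_left (hz i) ht0
    simp only [map_sub, map_add, map_smul, smul_eq_mul, h1]
    linarith

/-- At each point `x` of the polyhedron, either the kernel of `f` contains a direction leading into
the interior, or it contains no direction in which all inequalities tight at `x` stay tight. -/
def IsGenericProjection (a : ι → StrongDual ℝ E) (b : ι → ℝ) (f : E →L[ℝ] E') : Prop :=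
  ∀ x ∈ polyhedron a b, (∃ u, f u = 0 ∧ ∀ i ∈ tight a b x, a i u < 0) ∨
    ∀ u, f u = 0 → (∀ i ∈ tight a b x, a i u = 0) → u = 0

theorem exists_of_isProperFace [Finite ι] [FiniteDimensional ℝ E] [FiniteDimensional ℝ E']
    {f : E →L[ℝ] E'} (hf : Function.Surjective f) (hgen : IsGenericProjection a b f) {F : Set E'}
    (hF : IsProperFace (f '' polyhedron a b) F) :
    ∃ x ∈ polyhedron a b, F = f '' tightFace a b (tight a b x) ∧
      (∀ u, f u = 0 → (∀ i ∈ tight a b x, a i u = 0) → u = 0) ∧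
      ∃ l : StrongDual ℝ E', tightFace a b (tight a b x) = (l.comp f).toExposed (polyhedron a b) := by
  have h1 := hF.1.inter_preimage
  have h2 := image_inter_preimage_of_subset hF.1.subset
  have hne : (polyhedron a b ∩ f ⁻¹' F).Nonempty := by
    rw [← image_nonempty (f := f), h2]; exact hF.2.1
  rw [← tightFace_empty] at h1 hne
  obtain ⟨x, hx, hxF⟩ := h1.exists_eq_tightFace hne
  rw [tightFace_empty] at hx hxF
  refine ⟨x, hx.1, by rw [← hxF, h2], ?_, ?_⟩
  · refine (hgen x hx.1).resolve_left ?_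
    rintro ⟨u, hu, hxu⟩
    exact (hF.subset_frontier hx.2).2 (mem_interior_image_of_exists hf hx.1 hu hxu)
  · obtain ⟨l, hl⟩ := hF.1 hF.2.1
    refine ⟨l, ?_⟩
    rw [← hxF, hl]
    ext y
    constructor
    · rintro ⟨hy, -, h⟩
      exact ⟨hy, fun z hz => h _ (mem_image_of_mem _ hz)⟩
    · rintro ⟨hy, h⟩
      refine ⟨hy, mem_image_of_mem _ hy, ?_⟩
      rintro _ ⟨z, hz, rfl⟩
      exact h z hz

theorem isPolytope_polyhedron [Finite ι] (hP : IsCompact (polyhedron a b))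
    (hne : (polyhedron a b).Nonempty) : IsPolytope (polyhedron a b) := by
  rw [← tightFace_empty] at hne ⊢
  exact isPolytope_tightFace hP hne

theorem isCombinatorialCube_image [FiniteDimensional ℝ E'] {f : E →L[ℝ] E'} {x : E}
    (hcube : IsCombinatorialCube (tightFace a b (tight a b x)))
    (hinj : ∀ u, f u = 0 → (∀ i ∈ tight a b x, a i u = 0) → u = 0) :
    IsCombinatorialCube (f '' tightFace a b (tight a b x)) := by
  obtain ⟨g, c, hg⟩ := exists_section_tightFace f hinj
  exact hcube.image f g c hg

theorem interior_image_polyhedron_nonempty [Finite ι] [FiniteDimensional ℝ E]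
    [FiniteDimensional ℝ E'] {f : E →L[ℝ] E'} (hf : Function.Surjective f) {z : E}
    (hz : ∀ i, a i z < b i) : (interior (f '' polyhedron a b)).Nonempty :=
  ⟨f z, mem_interior_image_of_exists hf (u := 0) (fun i => (hz i).le) (map_zero f)
    fun i hi => absurd hi (hz i).ne⟩

theorem isCubicalPolytope_image [Finite ι] [FiniteDimensional ℝ E] [FiniteDimensional ℝ E']
    {f : E →L[ℝ] E'} (hf : Function.Surjective f) (hgen : IsGenericProjection a b f)
    (hP : IsCompact (polyhedron a b)) {z : E} (hz : ∀ i, a i z < b i)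
    (hcube : ∀ x ∈ polyhedron a b, IsCombinatorialCube (tightFace a b (tight a b x))) :
    IsCubicalPolytope (Module.finrank ℝ E') (f '' polyhedron a b) := by
  refine ⟨(isPolytope_polyhedron hP ⟨z, fun i => (hz i).le⟩).image f, ?_, fun F hF => ?_⟩
  · have hcv : Convex ℝ (f '' polyhedron a b) := convex_polyhedron.linear_image f.toLinearMap
    have h := hcv.interior_nonempty_iff_affineSpan_eq_top.1
      (interior_image_polyhedron_nonempty hf hz)
    rw [polyDim, ← direction_affineSpan, h, AffineSubspace.direction_top, finrank_top]
  · obtain ⟨x, hx, rfl, hinj, -⟩ := exists_of_isProperFace hf hgen hF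
    exact isCombinatorialCube_image (hcube x hx) hinj

/-- The projections under `f` of those faces of `P` on which some functional `h + l ∘ f` attains its
maximum over `P`. -/
def upperCells (P : Set E) (h : StrongDual ℝ E) (f : E →L[ℝ] E') : Set (Set E') :=
  {F | ∃ l : StrongDual ℝ E', F = f '' (h + l.comp f).toExposed P}

variable {f : E →L[ℝ] E'} {h : StrongDual ℝ E}

/-- An inward direction in the kernel of `(h, f)` would lead to an interior point with the maximal
value, which can still be raised along a vector with `h = 1`, `f = 0`. Hence the second alternative
of genericity holds, and a tight direction in the kernel of `f` has `h = 0`, as `h + l ∘ f` is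
constant on the face. -/
theorem exists_eq_tightFace_of_upper [Finite ι] (hf : Function.Surjective (h.prod f))
    (hgen : IsGenericProjection a b (h.prod f)) (hP : IsCompact (polyhedron a b))
    (hne : (polyhedron a b).Nonempty) (l : StrongDual ℝ E') :
    ∃ x ∈ polyhedron a b, (h + l.comp f).toExposed (polyhedron a b) = tightFace a b (tight a b x) ∧
      ∀ u, f u = 0 → (∀ i ∈ tight a b x, a i u = 0) → u = 0 := by
  have h1 : IsExposed ℝ (polyhedron a b) ((h + l.comp f).toExposed (polyhedron a b)) :=
    ContinuousLinearMap.toExposed.isExposed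
  have hne' := toExposed_nonempty hP hne (h + l.comp f)
  rw [← tightFace_empty] at h1 hne'
  obtain ⟨x, hx, hxG⟩ := h1.exists_eq_tightFace hne'
  rw [tightFace_empty] at hx hxG
  refine ⟨x, hx.1, hxG, fun u hu hxu => ?_⟩
  rcases hgen x hx.1 with ⟨v, hv, hxv⟩ | hinj
  · exfalso
    obtain ⟨t, ht⟩ := (eventually_add_smul_lt hx.1 hxv).exists
    have hv1 : h v = 0 := congrArg Prod.fst hv
    have hv2 : f v = 0 := congrArg Prod.snd hv
    obtain ⟨w, hw⟩ := hf (1, 0)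
    have hw1 : h w = 1 := congrArg Prod.fst hw
    have hw2 : f w = 0 := congrArg Prod.snd hw
    have hev := eventually_add_smul_mem (v := w) (fun i => (ht i).le)
      fun i hi => absurd hi (ht i).ne
    obtain ⟨s, hs, hs0⟩ := (hev.and self_mem_nhdsWithin).exists
    have hs0 : (0 : ℝ) < s := hs0
    have := hx.2 _ hs
    simp [hv1, hv2, hw1, hw2] at this
    linarith
  · refine hinj u ?_ hxu
    have hst := eventually_add_smul_mem_tightFace (v := u) (mem_tightFace_tight hx.1) hxu
    obtain ⟨t, ht, ht0⟩ := (hst.and self_mem_nhdsWithin).exists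
    have ht0 : (0 : ℝ) < t := ht0
    rw [← hxG] at ht
    have e1 := ht.2 x hx.1
    have e2 := hx.2 _ ht.1
    simp only [_root_.add_apply, ContinuousLinearMap.comp_apply, map_add, map_smul, hu,
      smul_eq_mul, map_zero, add_zero] at e1 e2
    have : t * h u = 0 := by linarith
    exact Prod.ext ((mul_eq_zero.1 this).resolve_left ht0.ne') hu

/-- Over an interior point take the highest point of the fibre. Its image under `(h, f)` is on the
boundary, and a supporting functional there, scaled to have height coefficient 1, exposes the
required upper face. -/
theorem interior_subset_sUnion_upperCells [Finite ι] [FiniteDimensional ℝ E]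
    [FiniteDimensional ℝ E'] (hf : Function.Surjective (h.prod f))
    (hP : IsCompact (polyhedron a b)) {z : E} (hz : ∀ i, a i z < b i) :
    interior (f '' polyhedron a b) ⊆ ⋃₀ upperCells (polyhedron a b) h f := by
  intro y hy
  obtain ⟨x', hx', rfl⟩ := interior_subset hy
  obtain ⟨x, ⟨hx, hxx'⟩, hmax⟩ := (hP.inter_right (isClosed_eq f.continuous
    (continuous_const (y := f x')))).exists_isMaxOn ⟨x', hx', rfl⟩ h.continuous.continuousOn
  replace hxx' : f x = f x' := hxx'
  rw [← hxx'] at hy ⊢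
  have hmax' : ∀ w ∈ polyhedron a b, f w = f x → h w ≤ h x :=
    fun w hw hwx => hmax ⟨hw, hwx.trans hxx'⟩
  have hQc : Convex ℝ (h.prod f '' polyhedron a b) :=
    convex_polyhedron.linear_image (h.prod f).toLinearMap
  have hni : h.prod f x ∉ interior (h.prod f '' polyhedron a b) := by
    intro hint
    have ht : Tendsto (fun t : ℝ => (h x + t, f x)) (𝓝 0) (𝓝 (h x + 0, f x)) :=
      Continuous.tendsto (by fun_prop) 0
    rw [add_zero] at ht
    have hev := (ht.eventually (isOpen_interior.mem_nhds hint)).filter_mono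
      (nhdsWithin_le_nhds (s := Ioi 0))
    obtain ⟨t, ht, ht0⟩ := (hev.and self_mem_nhdsWithin).exists
    have ht0 : (0 : ℝ) < t := ht0
    obtain ⟨w, hw, hwx⟩ := interior_subset ht
    have e1 : h w = h x + t := congrArg Prod.fst hwx
    have := hmax' w hw (congrArg Prod.snd hwx)
    linarith
  obtain ⟨φ, hφ⟩ := geometric_hahn_banach_open_point hQc.interior isOpen_interior hni
  have hle : ∀ w ∈ polyhedron a b, φ (h.prod f w) ≤ φ (h.prod f x) := by
    intro w hw
    have h1 : h.prod f w ∈ closure (interior (h.prod f '' polyhedron a b)) := by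
      rw [hQc.closure_interior_eq_closure_of_nonempty_interior
        (interior_image_polyhedron_nonempty hf hz)]
      exact subset_closure (mem_image_of_mem _ hw)
    exact closure_minimal (fun q hq => (hφ q hq).le)
      (isClosed_le φ.continuous continuous_const) h1
  have hsplit : ∀ w, φ (h.prod f w) = φ (1, 0) * h w + φ (0, f w) := by
    intro w
    have : h.prod f w = h w • ((1 : ℝ), (0 : E')) + (0, f w) := by
      ext <;> simp
    rw [this, map_add, map_smul, smul_eq_mul, mul_comm]
  -- The supporting hyperplane is not vertical: the fibre also contains a point of the open
  -- polyhedron, which is no higher than `x` and has a strictly smaller value of `φ`.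
  have hc : 0 < φ (1, 0) := by
    obtain ⟨u, hu, hxu⟩ := exists_of_mem_interior_image hz hy
    obtain ⟨t, ht⟩ := (eventually_add_smul_lt hx hxu).exists
    have hfx : f (x + t • u) = f x := by simp [hu]
    have h1 := hmax' (x + t • u) (fun i => (ht i).le) hfx
    have h2 := hφ _ (mem_interior_image_of_exists hf (u := 0) (fun i => (ht i).le) (map_zero _)
      fun i hi => absurd hi (ht i).ne)
    rw [hsplit, hsplit, hfx] at h2
    by_contra hc
    push Not at hc
    nlinarith
  refine mem_sUnion.2 ⟨_, ⟨(φ (1, 0))⁻¹ • φ.comp (ContinuousLinearMap.inr ℝ ℝ E'), rfl⟩,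
    mem_image_of_mem _ ⟨hx, fun w hw => ?_⟩⟩
  have h1 := hle w hw
  rw [hsplit, hsplit] at h1
  have h2 := mul_le_mul_of_nonneg_left h1 (inv_pos.2 hc).le
  have h3 := inv_mul_cancel₀ hc.ne'
  simp only [mul_add, ← mul_assoc, h3, one_mul] at h2
  simpa using h2

theorem finite_upperCells [Finite ι] : (upperCells (polyhedron a b) h f).Finite := by
  refine ((finite_setOf_isExposed (a := a) (b := b)).image (fun G => f '' G)).subset ?_
  rintro _ ⟨l, rfl⟩
  exact mem_image_of_mem _ ContinuousLinearMap.toExposed.isExposed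

theorem sUnion_upperCells [Finite ι] [FiniteDimensional ℝ E]
    [FiniteDimensional ℝ E'] (hf : Function.Surjective (h.prod f))
    (hP : IsCompact (polyhedron a b)) {z : E} (hz : ∀ i, a i z < b i) :
    ⋃₀ upperCells (polyhedron a b) h f = f '' polyhedron a b := by
  have hf' : Function.Surjective f := fun y => (hf (0, y)).imp fun x hx => congrArg Prod.snd hx
  refine Subset.antisymm (sUnion_subset ?_) ?_
  · rintro _ ⟨l, rfl⟩
    exact image_mono fun x hx => hx.1
  · have hcv : Convex ℝ (f '' polyhedron a b) := convex_polyhedron.linear_image f.toLinearMap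
    have hcl : IsClosed (⋃₀ upperCells (polyhedron a b) h f) := by
      rw [sUnion_eq_biUnion]
      refine finite_upperCells.isClosed_biUnion ?_
      rintro _ ⟨l, rfl⟩
      have hG : IsExposed ℝ (polyhedron a b) ((h + l.comp f).toExposed (polyhedron a b)) :=
        ContinuousLinearMap.toExposed.isExposed
      exact ((hG.isCompact hP).image f.continuous).isClosed
    refine subset_closure.trans ?_
    rw [← hcv.closure_interior_eq_closure_of_nonempty_interior
      (interior_image_polyhedron_nonempty hf' hz)]
    exact closure_minimal (interior_subset_sUnion_upperCells hf hP hz) hcl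

/-- Points of two upper faces with the same image have the same height, both being highest in their
fibre; so each of them lies in both faces. -/
theorem image_inter_image_of_upper {P : Set E} (l l' : StrongDual ℝ E') :
    f '' (h + l.comp f).toExposed P ∩ f '' (h + l'.comp f).toExposed P =
      f '' ((h + l.comp f).toExposed P ∩ (h + l'.comp f).toExposed P) := by
  refine Subset.antisymm ?_ (image_inter_subset _ _ _)
  rintro _ ⟨⟨x, hx, rfl⟩, y, hy, hyx⟩
  refine ⟨x, ⟨hx, hx.1, fun z hz => ?_⟩, rfl⟩
  have h1 := hx.2 y hy.1
  have h2 := hy.2 z hz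
  simp only [_root_.add_apply, ContinuousLinearMap.comp_apply, hyx] at h1 h2 ⊢
  linarith

theorem isExposed_image_inter_of_upper [Finite ι] [FiniteDimensional ℝ E']
    (hf : Function.Surjective (h.prod f))
    (hgen : IsGenericProjection a b (h.prod f)) (hP : IsCompact (polyhedron a b))
    (hne : (polyhedron a b).Nonempty) (l l' : StrongDual ℝ E') :
    IsExposed ℝ (f '' (h + l.comp f).toExposed (polyhedron a b))
      (f '' ((h + l.comp f).toExposed (polyhedron a b) ∩
        (h + l'.comp f).toExposed (polyhedron a b))) := by
  have hi : IsExposed ℝ (polyhedron a b) ((h + l.comp f).toExposed (polyhedron a b) ∩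
      (h + l'.comp f).toExposed (polyhedron a b)) :=
    IsExposed.inter ContinuousLinearMap.toExposed.isExposed
      ContinuousLinearMap.toExposed.isExposed
  have hi' := hi.mono (B := (h + l.comp f).toExposed (polyhedron a b)) (fun x hx => hx.1)
    inter_subset_left
  obtain ⟨x, hx, hxG, hinj⟩ := exists_eq_tightFace_of_upper hf hgen hP hne l
  obtain ⟨g, c, hg⟩ := exists_section_tightFace f hinj
  rw [← hxG] at hg
  exact hi'.image_of_section f g c hg

/-- The preimage of `F` is exposed by some `l ∘ f`, and on it `h` is an affine function of `f`.
Hence `h - h ∘ g ∘ f` is constant there; adding a small multiple of it to `l ∘ f` exposes the same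
face, and rescaling makes the coefficient of `h` equal to 1. -/
theorem mem_upperCells_of_isProperFace [Finite ι] [FiniteDimensional ℝ E] [FiniteDimensional ℝ E']
    (hf : Function.Surjective f) (hgen : IsGenericProjection a b f)
    (hP : IsCompact (polyhedron a b)) (hne : (polyhedron a b).Nonempty) {F : Set E'}
    (hF : IsProperFace (f '' polyhedron a b) F) : F ∈ upperCells (polyhedron a b) h f := by
  obtain ⟨x, hx, rfl, hinj, l, hl⟩ := exists_of_isProperFace hf hgen hF
  obtain ⟨g, c, hg⟩ := exists_section_tightFace f hinj
  obtain ⟨δ, hδ, hk⟩ := exists_toExposed_add_smul (isPolytope_polyhedron hP hne) (l.comp f)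
    (h - (h.comp g).comp f)
  rw [← hl] at hk
  have hconst : ∀ y ∈ tightFace a b (tight a b x), (h - (h.comp g).comp f) y = h c := by
    intro y hy
    conv_lhs => rw [← hg y hy]
    have := hg y hy
    simp only [_root_.sub_apply, ContinuousLinearMap.comp_apply]
    rw [this]
    conv_lhs => enter [1]; rw [← hg y hy]
    simp
  have hself : (h - (h.comp g).comp f).toExposed (tightFace a b (tight a b x)) =
      tightFace a b (tight a b x) :=
    Subset.antisymm (fun y hy => hy.1) fun y hy =>
      ⟨hy, fun z hz => by rw [hconst z hz, hconst y hy]⟩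
  refine ⟨δ⁻¹ • l - h.comp g, ?_⟩
  rw [← toExposed_smul hδ, ← hself, ← hk]
  congr 2
  ext y
  simp only [_root_.add_apply, _root_.smul_apply, _root_.sub_apply, smul_eq_mul,
    ContinuousLinearMap.comp_apply]
  field_simp
  ring

/-- The upper cells form a cubical subdivision of the projection. -/
theorem isCubicalSubdivision_upperCells [Finite ι] [FiniteDimensional ℝ E] [FiniteDimensional ℝ E']
    (hf : Function.Surjective (h.prod f)) (hgen : IsGenericProjection a b (h.prod f))
    (hgen' : IsGenericProjection a b f) (hP : IsCompact (polyhedron a b)) {z : E}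
    (hz : ∀ i, a i z < b i)
    (hcube : ∀ x ∈ polyhedron a b, IsCombinatorialCube (tightFace a b (tight a b x))) :
    IsCubicalSubdivision (upperCells (polyhedron a b) h f) (f '' polyhedron a b) := by
  have hf' : Function.Surjective f := fun y => (hf (0, y)).imp fun x hx => congrArg Prod.snd hx
  have hne : (polyhedron a b).Nonempty := ⟨z, fun i => (hz i).le⟩
  refine ⟨⟨finite_upperCells, ?_, ?_, ?_⟩, sUnion_upperCells hf hP hz,
    fun F hF => mem_upperCells_of_isProperFace hf' hgen' hP hne hF⟩
  · rintro _ ⟨l, rfl⟩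
    obtain ⟨x, hx, hxG, hinj⟩ := exists_eq_tightFace_of_upper hf hgen hP hne l
    rw [hxG]
    exact isCombinatorialCube_image (hcube x hx) hinj
  · rintro _ ⟨l, rfl⟩ G hG hGne
    obtain ⟨k, hk⟩ := hG hGne
    obtain ⟨δ, hδ, hδk⟩ := exists_toExposed_add_smul (isPolytope_polyhedron hP hne)
      (h + l.comp f) (k.comp f)
    refine ⟨l + δ • k, ?_⟩
    have e : h + (l + δ • k).comp f = h + l.comp f + δ • k.comp f := by
      ext y; simp [add_assoc]
    rw [e, hδk, hk]
    refine Subset.antisymm ?_ ?_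
    · rintro _ ⟨⟨x, hx, rfl⟩, hm⟩
      exact ⟨x, ⟨hx, fun y hy => hm _ (mem_image_of_mem _ hy)⟩, rfl⟩
    · rintro _ ⟨x, hx, rfl⟩
      refine ⟨mem_image_of_mem _ hx.1, ?_⟩
      rintro _ ⟨y, hy, rfl⟩
      exact hx.2 y hy
  · rintro _ ⟨l, rfl⟩ _ ⟨l', rfl⟩
    rw [image_inter_image_of_upper]
    refine ⟨isExposed_image_inter_of_upper hf hgen hP hne l l', ?_⟩
    rw [inter_comm]
    exact isExposed_image_inter_of_upper hf hgen hP hne l' l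

/-- The inequalities tight at a relative interior point of the face are tight at all its points, so
the bound on their number applies everywhere on the cell. -/
theorem subset_frontier_of_mem_upperCells [Finite ι] [FiniteDimensional ℝ E]
    [FiniteDimensional ℝ E'] (hf : Function.Surjective (h.prod f))
    (hgen : IsGenericProjection a b (h.prod f)) (hP : IsCompact (polyhedron a b)) {z : E}
    (hz : ∀ i, a i z < b i) {r : ℕ}
    (hr : ∀ x ∈ polyhedron a b, Module.finrank ℝ E ≤ r + (tight a b x).ncard →
      ¬ ∃ u, f u = 0 ∧ ∀ i ∈ tight a b x, a i u < 0)
    {F : Set E'} (hF : F ∈ upperCells (polyhedron a b) h f) (hFr : polyDim F = r) :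
    F ⊆ frontier (f '' polyhedron a b) := by
  obtain ⟨l, rfl⟩ := hF
  obtain ⟨x, hx, hxG, hinj⟩ := exists_eq_tightFace_of_upper hf hgen hP
    ⟨z, fun i => (hz i).le⟩ l
  have hdim := finrank_le_polyDim_add_ncard hx f hinj
  rw [hxG] at hFr ⊢
  rw [hFr] at hdim
  rintro _ ⟨y, hy, rfl⟩
  refine ⟨subset_closure (mem_image_of_mem _ hy.1), fun hint => ?_⟩
  refine hr y hy.1 (hdim.trans ?_) (exists_of_mem_interior_image hz hint)
  exact Nat.add_le_add_left (Set.ncard_le_ncard hy.2 (Set.toFinite _)) r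

/-- The nonempty faces of a polytope projected injectively form a cubical subdivision. -/
theorem isCubicalSubdivision_faces [Finite ι] [FiniteDimensional ℝ E'] {f : E →L[ℝ] E'}
    (hinj : ∀ u, f u = 0 → u = 0) (hne : (polyhedron a b).Nonempty)
    (hcube : ∀ x ∈ polyhedron a b, IsCombinatorialCube (tightFace a b (tight a b x))) :
    IsCubicalSubdivision {F | IsExposed ℝ (f '' polyhedron a b) F ∧ F.Nonempty}
      (f '' polyhedron a b) := by
  obtain ⟨g, hg⟩ : ∃ g : E' →L[ℝ] E, ∀ x, g (f x) + 0 = x := by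
    obtain ⟨g, hg⟩ := f.toLinearMap.exists_leftInverse_of_injective (LinearMap.ker_eq_bot'.2 hinj)
    exact ⟨g.toContinuousLinearMap, fun x => by simpa using LinearMap.congr_fun hg x⟩
  have key : ∀ F, IsExposed ℝ (f '' polyhedron a b) F → F.Nonempty →
      ∃ x ∈ polyhedron a b, F = f '' tightFace a b (tight a b x) := by
    intro F hF hFne
    have h1 := hF.inter_preimage
    have h2 := image_inter_preimage_of_subset hF.subset
    have hne : (polyhedron a b ∩ f ⁻¹' F).Nonempty := by
      rw [← image_nonempty (f := f), h2]; exact hFne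
    rw [← tightFace_empty] at h1 hne
    obtain ⟨x, hx, hxF⟩ := h1.exists_eq_tightFace hne
    rw [tightFace_empty] at hx hxF
    exact ⟨x, hx.1, by rw [← hxF, h2]⟩
  have hfin : {F | IsExposed ℝ (f '' polyhedron a b) F ∧ F.Nonempty}.Finite := by
    refine (Set.finite_range fun I => f '' tightFace a b I).subset ?_
    rintro F ⟨hF, hFne⟩
    obtain ⟨x, hx, rfl⟩ := key F hF hFne
    exact mem_range_self _
  refine ⟨⟨hfin, ?_, ?_, ?_⟩, ?_, fun F hF => ⟨hF.1, hF.2.1⟩⟩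
  · rintro F ⟨hF, hFne⟩
    obtain ⟨x, hx, rfl⟩ := key F hF hFne
    exact (hcube x hx).image f g 0 fun y _ => hg y
  · rintro F ⟨hF, hFne⟩ G hG hGne
    obtain ⟨x, hx, rfl⟩ := key F hF hFne
    have h1 := (hG.inter_preimage.trans_tightFace).image_of_section f g 0 fun y _ => hg y
    rw [image_inter_preimage_of_subset hG.subset] at h1
    exact ⟨h1, hGne⟩
  · rintro F ⟨hF, -⟩ G ⟨hG, -⟩
    exact ⟨(hF.inter hG).mono hF.subset inter_subset_left,
      (hF.inter hG).mono hG.subset inter_subset_right⟩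
  · refine Subset.antisymm (sUnion_subset fun F hF => hF.1.subset) ?_
    exact subset_sUnion_of_mem ⟨IsExposed.refl _, hne.image f⟩

end UpperCells

/-! ### Combinatorics of the deformed cube -/

section DeformedCube

open Set Filter Topology

variable {n : ℕ} {ε : ℝ}

/-- The sum occurring in the `k`-th inequality of the deformed cube. -/
noncomputable def chooseSum (x : Fin n → ℝ) (k : Fin n) : ℝ :=
  ∑ j ∈ Finset.Iio k, (((k : ℕ) - 1).choose (j : ℕ) : ℝ) * x j

/-- The constant occurring in the `k`-th inequality of the deformed cube. -/
noncomputable def cubeBound (ε : ℝ) (k : ℕ) : ℝ := 2 ^ ((k + 1).choose 2) / ε ^ k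

/-- The sign `1` or `-1` encoded by a Boolean. -/
def boolSign (s : Bool) : ℝ := if s then 1 else -1

/-- The outer normal vectors of the facets of the deformed cube. -/
noncomputable def cubeRow (n : ℕ) (ε : ℝ) (i : Fin n × Bool) : StrongDual ℝ (Fin n → ℝ) :=
  (ε * boolSign i.2) • ContinuousLinearMap.proj i.1 +
    (-1 : ℝ) ^ ((i.1 : ℕ) + 1) • ∑ j ∈ Finset.Iio i.1,
      (((i.1 : ℕ) - 1).choose (j : ℕ) : ℝ) • ContinuousLinearMap.proj (R := ℝ) j

theorem cubeRow_apply (k : Fin n) (s : Bool) (x : Fin n → ℝ) :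
    cubeRow n ε (k, s) x =
      ε * boolSign s * x k + (-1) ^ ((k : ℕ) + 1) * chooseSum x k := by
  simp [cubeRow, chooseSum]

/-- The right-hand side of the `k`-th inequality of the deformed cube. -/
noncomputable def cubeSlack (ε : ℝ) (x : Fin n → ℝ) (k : Fin n) : ℝ :=
  cubeBound ε k - (-1) ^ ((k : ℕ) + 1) * chooseSum x k

theorem mem_deformedCube {x : Fin n → ℝ} :
    x ∈ deformedCube n ε ↔ ∀ k, ε * |x k| ≤ cubeSlack ε x k := Iff.rfl

theorem deformedCube_eq_polyhedron (hε : 0 < ε) :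
    deformedCube n ε = polyhedron (cubeRow n ε) fun i => cubeBound ε i.1 := by
  ext x
  rw [mem_deformedCube]
  simp only [polyhedron, mem_ofPred_eq, Prod.forall, Bool.forall_bool, cubeRow_apply, boolSign,
    cubeSlack]
  refine forall_congr' fun k => ?_
  rw [← abs_of_pos hε, ← abs_mul, abs_of_pos hε, abs_le]
  simp only [Bool.false_eq_true, if_false, if_true]
  constructor
  · rintro ⟨h1, h2⟩; constructor <;> linarith
  · rintro ⟨h1, h2⟩; constructor <;> linarith

theorem mem_tight_cube_iff {x : Fin n → ℝ} {k : Fin n} {s : Bool} :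
    (k, s) ∈ tight (cubeRow n ε) (fun i => cubeBound ε i.1) x ↔
      ε * boolSign s * x k = cubeSlack ε x k := by
  simp only [tight, mem_ofPred_eq, cubeRow_apply, cubeSlack]
  constructor <;> intro h <;> linarith

/-- The constraints on earlier coordinates keep the right-hand side of each inequality of the
deformed cube positive. -/
def IsTame (n : ℕ) (ε : ℝ) : Prop :=
  ∀ (x : Fin n → ℝ) (k : Fin n), (∀ j < k, ε * |x j| ≤ cubeSlack ε x j) →
    |chooseSum x k| < cubeBound ε k

/-- By induction `ε^(j+1) |x_j| < 2 · 2^(j+1 choose 2)` for `j < k`. In `ε^k` times the sum, the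
term `j = k - 1` has coefficient 1 and is less than `2 · 2^(k choose 2)`; all other terms carry a
spare factor `ε` and total less than 1. The bound is `2^(k+1 choose 2) = 2^(k choose 2) · 2^k`. -/
theorem eventually_isTame (n : ℕ) : ∀ᶠ ε in 𝓝[>] (0 : ℝ), IsTame n ε := by
  let m : Fin n → ℝ := fun j => 2 * 2 ^ (((j : ℕ) + 1).choose 2)
  have hm : ∀ j, 0 ≤ m j := fun j => by positivity
  have h1 : ∀ᶠ ε in 𝓝[>] (0 : ℝ), ∀ k : Fin n,
      ε * ∑ j : Fin n, (((k : ℕ) - 1).choose (j : ℕ) : ℝ) * m j < 1 := by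
    refine eventually_all.2 fun k => ?_
    have ht : Tendsto (fun ε : ℝ => ε * ∑ j : Fin n, (((k : ℕ) - 1).choose (j : ℕ) : ℝ) * m j)
        (𝓝 0) (𝓝 (0 * ∑ j : Fin n, (((k : ℕ) - 1).choose (j : ℕ) : ℝ) * m j)) :=
      Continuous.tendsto (by fun_prop) 0
    rw [zero_mul] at ht
    exact (ht.eventually (gt_mem_nhds one_pos)).filter_mono nhdsWithin_le_nhds
  have h2 : ∀ᶠ ε in 𝓝[>] (0 : ℝ), ε < 1 :=
    (gt_mem_nhds one_pos).filter_mono nhdsWithin_le_nhds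
  filter_upwards [h1, h2, self_mem_nhdsWithin] with ε hεK hε1 hε0
  replace hε0 : 0 < ε := hε0
  intro x k
  induction k using WellFoundedLT.induction with
  | _ k ih =>
  intro hk
  have hy : ∀ j < k, ε ^ ((j : ℕ) + 1) * |x j| < m j := by
    intro j hj
    have e1 := hk j hj
    have e2 := ih j hj fun i hi => hk i (hi.trans hj)
    have e3 := neg_le_abs ((-1) ^ ((j : ℕ) + 1) * chooseSum x j)
    rw [abs_mul, abs_pow, abs_neg, abs_one, one_pow, one_mul] at e3
    have e4 : ε * |x j| < 2 * cubeBound ε j := by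
      unfold cubeSlack at e1
      linarith
    have e5 : ε ^ (j : ℕ) * cubeBound ε j = 2 ^ (((j : ℕ) + 1).choose 2) := by
      unfold cubeBound
      field_simp
    have e6 := mul_lt_mul_of_pos_left e4 (pow_pos hε0 (j : ℕ))
    calc _ = ε ^ (j : ℕ) * (ε * |x j|) := by ring
      _ < _ := e6
      _ = m j := by rw [mul_left_comm, e5]
  rw [cubeBound, lt_div_iff₀ (pow_pos hε0 _), mul_comm]
  have hle : ε ^ (k : ℕ) * |chooseSum x k| ≤
      ∑ j ∈ Finset.Iio k, (((k : ℕ) - 1).choose (j : ℕ) : ℝ) * (ε ^ (k : ℕ) * |x j|) := by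
    refine (mul_le_mul_of_nonneg_left (Finset.abs_sum_le_sum_abs _ _)
      (pow_pos hε0 _).le).trans_eq ?_
    rw [Finset.mul_sum]
    refine Finset.sum_congr rfl fun j _ => ?_
    rw [abs_mul, Nat.abs_cast]
    ring
  refine hle.trans_lt ?_
  obtain ⟨_ | l, hl⟩ := k
  · have : Finset.Iio (⟨0, hl⟩ : Fin n) = ∅ := by
      ext j; simp [Fin.lt_def]
    rw [this]
    simp
  let j₀ : Fin n := ⟨l, by omega⟩
  have hj₀ : j₀ ∈ Finset.Iio (⟨l + 1, hl⟩ : Fin n) := by simp [j₀, Fin.lt_def]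
  rw [← Finset.add_sum_erase _ _ hj₀]
  have h3 : (((l + 1 - 1).choose (j₀ : ℕ) : ℝ)) * (ε ^ (l + 1) * |x j₀|) < m j₀ := by
    have := hy j₀ (Finset.mem_Iio.1 hj₀)
    simpa [j₀] using this
  have hchoose : (l + 1 + 1).choose 2 = (l + 1).choose 2 + (l + 1) := by
    rw [Nat.choose_succ_succ' (l + 1) 1, Nat.choose_one_right, add_comm]
  -- For `l = 0` the two sides agree up to the strict inequality `h3`, and there are no other terms.
  -- For `l ≥ 1` the factor `2^(l+1) ≥ 4` leaves room for them.
  rcases Nat.eq_zero_or_pos l with rfl | hlpos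
  · have h4 : (Finset.Iio (⟨0 + 1, hl⟩ : Fin n)).erase j₀ = ∅ := by
      refine Finset.eq_empty_of_forall_notMem fun j hj => ?_
      simp only [Finset.mem_erase, Finset.mem_Iio] at hj
      have e1 := Fin.lt_def.1 hj.2
      exact hj.1 (Fin.ext (by simp only [j₀] at e1 ⊢; omega))
    rw [h4, Finset.sum_empty, add_zero]
    refine h3.trans_le ?_
    simp [m, j₀]
  · have h5 : ∑ j ∈ (Finset.Iio (⟨l + 1, hl⟩ : Fin n)).erase j₀,
        (((l + 1 - 1).choose (j : ℕ) : ℝ)) * (ε ^ (l + 1) * |x j|) ≤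
        ε * ∑ j : Fin n, (((l + 1 - 1).choose (j : ℕ) : ℝ)) * m j := by
      rw [Finset.mul_sum]
      refine (Finset.sum_le_sum fun j hj => ?_).trans
        (Finset.sum_le_sum_of_subset_of_nonneg (Finset.subset_univ _) fun j _ _ =>
          mul_nonneg hε0.le (mul_nonneg (Nat.cast_nonneg _) (hm j)))
      simp only [Finset.mem_erase, Finset.mem_Iio] at hj
      have hjl : (j : ℕ) < l := by
        have e1 := hj.1
        have e2 := Fin.lt_def.1 hj.2
        simp only [ne_eq, Fin.ext_iff, j₀] at e1 e2
        omega
      have e3 := hy j hj.2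
      obtain ⟨q, rfl⟩ : ∃ q, l = j + 1 + q := ⟨l - j - 1, by omega⟩
      rw [mul_left_comm ε]
      refine mul_le_mul_of_nonneg_left ?_ (Nat.cast_nonneg _)
      calc ε ^ ((j : ℕ) + 1 + q + 1) * |x j|
          = (ε ^ q * ε) * (ε ^ ((j : ℕ) + 1) * |x j|) := by ring
        _ ≤ (1 * ε) * m j := by
            refine mul_le_mul ?_ e3.le (by positivity) (by positivity)
            exact mul_le_mul_of_nonneg_right (pow_le_one₀ hε0.le hε1.le) hε0.le
        _ = ε * m j := by ring
    have h6 := hεK ⟨l + 1, hl⟩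
    refine (add_lt_add_of_lt_of_le h3 h5).trans_le ?_
    have h7 : (1 : ℝ) ≤ 2 ^ ((l + 1).choose 2) := one_le_pow₀ (by norm_num)
    have h8 : (4 : ℝ) ≤ 2 ^ (l + 1) := by
      calc (4 : ℝ) = 2 ^ 2 := by norm_num
        _ ≤ 2 ^ (l + 1) := pow_le_pow_right₀ (by norm_num) (by omega)
    have h9 := mul_le_mul_of_nonneg_left h8 (zero_le_one.trans h7)
    have h10 : m j₀ = 2 * 2 ^ ((l + 1).choose 2) := rfl
    change _ ≤ (2 : ℝ) ^ ((l + 1 + 1).choose 2)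
    rw [hchoose, pow_add, h10]
    simp only at h6
    linarith

theorem cubeSlack_pos_of_isTame (hT : IsTame n ε) {x : Fin n → ℝ} {k : Fin n}
    (h : ∀ j < k, ε * |x j| ≤ cubeSlack ε x j) : 0 < cubeSlack ε x k := by
  have h1 := hT x k h
  have h2 := le_abs_self ((-1) ^ ((k : ℕ) + 1) * chooseSum x k)
  rw [abs_mul, abs_pow, abs_neg, abs_one, one_pow, one_mul] at h2
  unfold cubeSlack
  linarith

theorem cubeSlack_lt_of_isTame (hT : IsTame n ε) {x : Fin n → ℝ} {k : Fin n}
    (h : ∀ j < k, ε * |x j| ≤ cubeSlack ε x j) : cubeSlack ε x k < 2 * cubeBound ε k := by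
  have h1 := hT x k h
  have h2 := neg_le_abs ((-1) ^ ((k : ℕ) + 1) * chooseSum x k)
  rw [abs_mul, abs_pow, abs_neg, abs_one, one_pow, one_mul] at h2
  unfold cubeSlack
  linarith

theorem isCompact_deformedCube (hε : 0 < ε) (hT : IsTame n ε) : IsCompact (deformedCube n ε) := by
  refine (isCompact_Icc (a := fun k : Fin n => -(2 * cubeBound ε k / ε))
    (b := fun k : Fin n => 2 * cubeBound ε k / ε)).of_isClosed_subset ?_ fun x hx => ?_
  · rw [deformedCube_eq_polyhedron hε]
    exact isClosed_polyhedron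
  · have key : ∀ k, |x k| ≤ 2 * cubeBound ε k / ε := fun k => by
      rw [le_div_iff₀ hε, mul_comm]
      exact (hx k).trans (cubeSlack_lt_of_isTame hT fun j _ => hx j).le
    exact ⟨fun k => (abs_le.1 (key k)).1, fun k => (abs_le.1 (key k)).2⟩

/-- The point of the deformed cube with prescribed relative position in each coordinate. -/
noncomputable def cubePointSeq (ε : ℝ) (t : ℕ → ℝ) : ℕ → ℝ
  | k => t k / ε * (cubeBound ε k -
      (-1) ^ (k + 1) * ∑ j : Fin k, ((k - 1).choose (j : ℕ) : ℝ) * cubePointSeq ε t j)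

theorem chooseSum_eq_sum_fin (y : ℕ → ℝ) (k : Fin n) :
    chooseSum (fun j => y j) k = ∑ j : Fin k, (((k : ℕ) - 1).choose (j : ℕ) : ℝ) * y j := by
  rw [← Finset.sum_range fun j => (((k : ℕ) - 1).choose j : ℝ) * y j, ← Nat.Iio_eq_range,
    ← Fin.map_valEmbedding_Iio, Finset.sum_map]
  rfl

theorem exists_mul_eq_mul_cubeSlack (hε : 0 < ε) (t : Fin n → ℝ) :
    ∃ x : Fin n → ℝ, ∀ k, ε * x k = t k * cubeSlack ε x k := by
  refine ⟨fun k => cubePointSeq ε (fun k => if h : k < n then t ⟨k, h⟩ else 0) k, fun k => ?_⟩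
  rw [cubeSlack, chooseSum_eq_sum_fin]
  beta_reduce
  conv_lhs => rw [cubePointSeq]
  simp only [Fin.is_lt, dite_true, Fin.eta]
  field_simp

/-- No two opposite facets. -/
def IsConsistent (I : Set (Fin n × Bool)) : Prop := ∀ k, (k, true) ∈ I → (k, false) ∉ I

/-- The coordinates are chosen recursively: each ranges over an interval of positive length, of
which the upper end, the lower end or the midpoint is taken as `I` prescribes. -/
theorem exists_tight_eq (hε : 0 < ε) (hT : IsTame n ε) {I : Set (Fin n × Bool)}
    (hI : IsConsistent I) : ∃ x ∈ polyhedron (cubeRow n ε) (fun i => cubeBound ε i.1),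
      tight (cubeRow n ε) (fun i => cubeBound ε i.1) x = I := by
  classical
  let t : Fin n → ℝ := fun k => if (k, true) ∈ I then 1 else if (k, false) ∈ I then -1 else 0
  have ht : ∀ k, |t k| ≤ 1 := fun k => by
    dsimp only [t]; split_ifs <;> simp
  obtain ⟨x, hx⟩ := exists_mul_eq_mul_cubeSlack hε t
  have hmem : ∀ k, ε * |x k| ≤ cubeSlack ε x k := by
    intro k
    induction k using WellFoundedLT.induction with
    | _ k ih =>
    have h1 := cubeSlack_pos_of_isTame hT ih
    have h2 : ε * |x k| = |t k| * cubeSlack ε x k := by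
      rw [← abs_of_pos h1, ← abs_mul, ← hx, abs_mul, abs_of_pos hε]
    rw [h2]
    exact mul_le_of_le_one_left h1.le (ht k)
  refine ⟨x, by rw [← deformedCube_eq_polyhedron hε]; exact hmem, ?_⟩
  ext ⟨k, s⟩
  have hpos := cubeSlack_pos_of_isTame hT (k := k) fun j _ => hmem j
  rw [mem_tight_cube_iff, mul_right_comm, hx, mul_right_comm,
    mul_eq_right₀ hpos.ne']
  have hc := hI k
  dsimp only [t]
  cases s <;> by_cases h1 : (k, true) ∈ I <;> by_cases h2 : (k, false) ∈ I <;>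
    simp [boolSign, h1, h2] at hc ⊢ <;> norm_num

theorem isConsistent_tight (hε : 0 < ε) (hT : IsTame n ε) {x : Fin n → ℝ}
    (hx : x ∈ polyhedron (cubeRow n ε) (fun i => cubeBound ε i.1)) :
    IsConsistent (tight (cubeRow n ε) (fun i => cubeBound ε i.1) x) := by
  rw [← deformedCube_eq_polyhedron hε] at hx
  intro k h1 h2
  have hpos := cubeSlack_pos_of_isTame hT (k := k) fun j _ => hx j
  rw [mem_tight_cube_iff] at h1 h2
  simp only [boolSign, if_true, Bool.false_eq_true, if_false] at h1 h2
  linarith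

theorem exists_forall_cubeRow_lt (hε : 0 < ε) (hT : IsTame n ε) :
    ∃ z, ∀ i, cubeRow n ε i z < cubeBound ε i.1 := by
  obtain ⟨z, hz, h⟩ := exists_tight_eq hε hT (I := ∅) fun k h => absurd h (notMem_empty _)
  exact ⟨z, fun i => lt_of_le_of_ne (hz i) fun hi => notMem_empty i (h ▸ hi)⟩

open Classical in
/-- The inequalities describing the standard cube with coordinates the indices not occurring in `I`,
together with inequalities for the other indices which are always tight or never tight. -/
noncomputable def freeRow (I : Set (Fin n × Bool)) {m : ℕ}
    (e : {k : Fin n // ∀ s, (k, s) ∉ I} ≃ Fin m) (i : Fin n × Bool) : StrongDual ℝ (Fin m → ℝ) :=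
  if h : ∀ s, (i.1, s) ∉ I then boolSign i.2 • ContinuousLinearMap.proj (e ⟨i.1, h⟩) else 0

open Classical in
/-- The constants of the inequalities given by `freeRow`. -/
noncomputable def freeBound (I : Set (Fin n × Bool)) (i : Fin n × Bool) : ℝ :=
  if ∀ s, (i.1, s) ∉ I then (if i.2 then 1 else 0) else (if i ∈ I then 0 else 1)

variable {I : Set (Fin n × Bool)} {m : ℕ} {e : {k : Fin n // ∀ s, (k, s) ∉ I} ≃ Fin m}

theorem polyhedron_free : polyhedron (freeRow I e) (freeBound I) = Icc 0 1 := by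
  ext y
  constructor
  · intro hy
    have key : ∀ l, 0 ≤ y l ∧ y l ≤ 1 := by
      intro l
      obtain ⟨k, rfl⟩ := e.surjective l
      have h1 := hy (k.1, true)
      have h2 := hy (k.1, false)
      have hk := k.2
      simp [freeRow, freeBound, hk, boolSign, -Bool.forall_bool] at h1 h2
      exact ⟨h2, h1⟩
    exact ⟨fun l => (key l).1, fun l => (key l).2⟩
  · rintro ⟨h0, h1⟩ ⟨k, s⟩
    by_cases h : ∀ s, (k, s) ∉ I
    · have e0 : 0 ≤ y (e ⟨k, h⟩) := h0 _
      have e1 : y (e ⟨k, h⟩) ≤ 1 := h1 _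
      cases s <;> simp [freeRow, freeBound, h, boolSign, -Bool.forall_bool, e0, e1]
    · by_cases hs : (k, s) ∈ I <;> simp [freeRow, freeBound, h, hs, -Bool.forall_bool]

theorem mem_tight_free_of_free {y : Fin m → ℝ} {k : Fin n} (h : ∀ s, (k, s) ∉ I) {s : Bool} :
    (k, s) ∈ tight (freeRow I e) (freeBound I) y ↔ y (e ⟨k, h⟩) = if s then 1 else 0 := by
  cases s <;> simp [tight, freeRow, freeBound, h, boolSign, -Bool.forall_bool]

theorem mem_tight_free_of_not_free {y : Fin m → ℝ} {k : Fin n} (h : ¬ ∀ s, (k, s) ∉ I)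
    {s : Bool} : (k, s) ∈ tight (freeRow I e) (freeBound I) y ↔ (k, s) ∈ I := by
  by_cases hs : (k, s) ∈ I <;> simp [tight, freeRow, freeBound, h, hs, -Bool.forall_bool]

theorem isConsistent_tight_free (hI : IsConsistent I) (y : Fin m → ℝ) :
    IsConsistent (tight (freeRow I e) (freeBound I) y) := by
  intro k
  by_cases h : ∀ s, (k, s) ∉ I
  · rw [mem_tight_free_of_free h, mem_tight_free_of_free h]
    intro h1
    rw [h1]
    norm_num
  · rw [mem_tight_free_of_not_free h, mem_tight_free_of_not_free h]
    exact hI k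

theorem subset_tight_free (y : Fin m → ℝ) : I ⊆ tight (freeRow I e) (freeBound I) y := by
  rintro ⟨k, s⟩ hk
  rwa [mem_tight_free_of_not_free fun h => h s hk]

theorem exists_tight_free_eq {J : Set (Fin n × Bool)} (hJ : IsConsistent J) (hIJ : I ⊆ J) :
    ∃ y ∈ polyhedron (freeRow I e) (freeBound I), tight (freeRow I e) (freeBound I) y = J := by
  classical
  let y : Fin m → ℝ := fun l => if ((e.symm l).1, true) ∈ J then 1 else
    if ((e.symm l).1, false) ∈ J then 0 else 1 / 2
  refine ⟨y, ?_, ?_⟩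
  · rw [polyhedron_free]
    constructor <;> intro l <;> dsimp only [y] <;> split_ifs <;> norm_num
  · ext ⟨k, s⟩
    have hc := hJ k
    by_cases h : ∀ s, (k, s) ∉ I
    · rw [mem_tight_free_of_free h]
      dsimp only [y]
      rw [Equiv.symm_apply_apply]
      cases s <;> by_cases h1 : (k, true) ∈ J <;> by_cases h2 : (k, false) ∈ J <;>
        simp [h1, h2] at hc ⊢
    · rw [mem_tight_free_of_not_free h]
      refine ⟨fun hk => hIJ hk, fun hk => ?_⟩
      push Not at h
      obtain ⟨s', hs'⟩ := h
      have h3 := hIJ hs'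
      cases s <;> cases s' <;> first | exact hs' | exact absurd hk (hc h3) | exact absurd h3 (hc hk)

/-- The faces of the deformed cube are combinatorial cubes. -/
theorem isCombinatorialCube_tightFace (hε : 0 < ε) (hT : IsTame n ε) {x : Fin n → ℝ}
    (hx : x ∈ polyhedron (cubeRow n ε) (fun i => cubeBound ε i.1)) :
    IsCombinatorialCube (tightFace (cubeRow n ε) (fun i => cubeBound ε i.1)
      (tight (cubeRow n ε) (fun i => cubeBound ε i.1) x)) := by
  classical
  have hc := isCompact_deformedCube hε hT
  rw [deformedCube_eq_polyhedron hε] at hc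
  refine ⟨isPolytope_tightFace hc ⟨x, mem_tightFace_tight hx⟩, ?_⟩
  have hI := isConsistent_tight hε hT hx
  set I := tight (cubeRow n ε) (fun i => cubeBound ε i.1) x with hIdef
  let e := Fintype.equivFin {k : Fin n // ∀ s, (k, s) ∉ I}
  refine ⟨Fintype.card {k : Fin n // ∀ s, (k, s) ∉ I}, ?_⟩
  rw [← polyhedron_free (e := e), ← tightFace_empty]
  -- On both sides the tight sets that occur are exactly the consistent sets containing `I`.
  refine nonempty_facePoset_tightFace_orderIso (fun w hw => ?_) fun y hy => ?_
  · obtain ⟨y, hy, h⟩ := exists_tight_free_eq (e := e) (isConsistent_tight hε hT hw.1) hw.2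
    exact ⟨y, ⟨hy, empty_subset _⟩, h.symm⟩
  · obtain ⟨w, hw, h⟩ := exists_tight_eq hε hT (isConsistent_tight_free (e := e) hI y)
    exact ⟨w, ⟨hw, h ▸ subset_tight_free y⟩, h.symm⟩

end DeformedCube

/-! ### Rows on the kernel as values of polynomials -/

section ChooseEval

open Set Filter Topology Polynomial

variable {n m : ℕ} {ε : ℝ}

/-- The value at `t` of the polynomial with coefficients `u` in the basis of binomial
coefficients. -/
noncomputable def chooseEval (u : Fin n → ℝ) (t : ℕ) : ℝ :=
  ∑ j : Fin n, (t.choose (j : ℕ) : ℝ) * u j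

/-- The polynomial with coefficients `u` in the basis of binomial coefficients. -/
noncomputable def choosePoly (u : Fin n → ℝ) : ℝ[X] :=
  ∑ j : Fin n, C (u j / ((j : ℕ).factorial : ℝ)) * descPochhammer ℝ j

theorem eval_choosePoly (u : Fin n → ℝ) (t : ℕ) : (choosePoly u).eval (t : ℝ) = chooseEval u t := by
  simp only [choosePoly, chooseEval, eval_finsetSum, eval_mul, eval_C]
  refine Finset.sum_congr rfl fun j _ => ?_
  rw [descPochhammer_eval_eq_descFactorial, Nat.descFactorial_eq_factorial_mul_choose,
    Nat.cast_mul]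
  field_simp

theorem chooseEval_eq_sum_Iio (u : Fin n → ℝ) {t : ℕ} {k : Fin n} (hk : t < k) :
    chooseEval u t = ∑ j ∈ Finset.Iio k, (t.choose (j : ℕ) : ℝ) * u j := by
  refine (Finset.sum_subset (Finset.subset_univ _) fun j _ hj => ?_).symm
  rw [Finset.mem_Iio, not_lt, Fin.le_def] at hj
  rw [Nat.choose_eq_zero_of_lt (by omega), Nat.cast_zero, zero_mul]

/-- Index 0 is a true exception: its sum is empty, while `chooseEval u 0` is the coordinate `u 0`.
-/
theorem chooseSum_eq_chooseEval (u : Fin n → ℝ) {k : Fin n} (hk : 0 < (k : ℕ)) :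
    chooseSum u k = chooseEval u (k - 1) :=
  (chooseEval_eq_sum_Iio u (by omega)).symm

theorem chooseEval_eq_zero_of_forall_le {u : Fin n → ℝ} {t : ℕ}
    (h : ∀ j : Fin n, (j : ℕ) ≤ t → u j = 0) : chooseEval u t = 0 := by
  refine Finset.sum_eq_zero fun j _ => ?_
  by_cases hj : (j : ℕ) ≤ t
  · rw [h j hj, mul_zero]
  · rw [Nat.choose_eq_zero_of_lt (by omega), Nat.cast_zero, zero_mul]

theorem eq_zero_of_chooseEval_eq_zero {u : Fin n → ℝ} (h : ∀ t, chooseEval u t = 0) : u = 0 := by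
  funext k
  induction k using WellFoundedLT.induction with
  | _ k ih =>
  have h1 := h k
  rw [chooseEval, Finset.sum_eq_single k] at h1
  · simpa using h1
  · intro j _ hj
    rcases lt_or_gt_of_ne hj with hlt | hlt
    · rw [ih j hlt, Pi.zero_apply, mul_zero]
    · rw [Nat.choose_eq_zero_of_lt (Fin.lt_def.1 hlt), Nat.cast_zero, zero_mul]
  · simp

theorem natDegree_choosePoly_lt {u : Fin n → ℝ} (hu : ∀ i : Fin n, m ≤ i → u i = 0) (hm : 0 < m) :
    (choosePoly u).natDegree < m := by
  refine Nat.lt_of_le_pred hm (natDegree_sum_le_of_forall_le _ _ fun j _ => ?_)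
  by_cases hj : m ≤ (j : ℕ)
  · simp [hu j hj]
  · refine (natDegree_C_mul_le _ _).trans ?_
    rw [descPochhammer_natDegree, Nat.pred_eq_sub_one]
    omega

theorem eq_zero_of_chooseEval_eq_zero_on {u : Fin n → ℝ} (hu : ∀ i : Fin n, m ≤ i → u i = 0)
    {T : Finset ℕ} (hT : m ≤ T.card) (h : ∀ t ∈ T, chooseEval u t = 0) : u = 0 := by
  rcases Nat.eq_zero_or_pos m with rfl | hm
  · exact funext fun i => hu i (Nat.zero_le _)
  have hp : choosePoly u = 0 := by
    refine eq_zero_of_natDegree_lt_card_of_eval_eq_zero' _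
      (T.map ⟨((↑) : ℕ → ℝ), Nat.cast_injective⟩) (fun x hx => ?_) ?_
    · obtain ⟨t, ht, rfl⟩ := Finset.mem_map.1 hx
      exact (eval_choosePoly u t).trans (h t ht)
    · rw [Finset.card_map]
      exact (natDegree_choosePoly_lt hu hm).trans_le hT
  refine eq_zero_of_chooseEval_eq_zero fun t => ?_
  rw [← eval_choosePoly, hp, eval_zero]

/-- A polynomial of degree less than `m` is controlled by its values at `m` points. -/
theorem exists_mul_norm_le_of_chooseEval_le (n : ℕ) {T : Finset ℕ} (hT : m ≤ T.card) :
    ∃ δ > (0 : ℝ), ∀ u : Fin n → ℝ, (∀ i : Fin n, m ≤ i → u i = 0) → ∀ c, 0 ≤ c →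
      (∀ t ∈ T, |chooseEval u t| ≤ c) → δ * ‖u‖ ≤ c := by
  let W : Submodule ℝ (Fin n → ℝ) :=
    { carrier := {u | ∀ i : Fin n, m ≤ i → u i = 0}
      add_mem' := fun hu hv i hi => by simp [hu i hi, hv i hi]
      zero_mem' := fun i _ => rfl
      smul_mem' := fun c u hu i hi => by simp [hu i hi] }
  let L : W →ₗ[ℝ] (T → ℝ) :=
    { toFun := fun u t => chooseEval u.1 t
      map_add' := fun u v => by
        funext t; simp [chooseEval, mul_add, Finset.sum_add_distrib]
      map_smul' := fun c u => by
        funext t; simp [chooseEval, Finset.mul_sum, mul_left_comm] }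
  have hL : LinearMap.ker L = ⊥ := LinearMap.ker_eq_bot'.2 fun u hu =>
    Subtype.ext (eq_zero_of_chooseEval_eq_zero_on u.2 hT fun t ht => congrFun hu ⟨t, ht⟩)
  obtain ⟨K, hK, hKL⟩ := L.exists_antilipschitzWith hL
  have hK0 : (0 : ℝ) < K := hK
  refine ⟨(K : ℝ)⁻¹, inv_pos.2 hK0, fun u hu c hc h => ?_⟩
  have h1 := hKL.le_mul_dist ⟨u, hu⟩ 0
  rw [map_zero, dist_zero_right, dist_zero_right] at h1
  have h2 : ‖L ⟨u, hu⟩‖ ≤ c := (pi_norm_le_iff_of_nonneg hc).2 fun t => h t.1 t.2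
  have h3 : ‖u‖ ≤ K * c := h1.trans (mul_le_mul_of_nonneg_left h2 hK0.le)
  rw [inv_mul_le_iff₀ hK0]
  exact h3

theorem abs_boolSign (s : Bool) : |boolSign s| = 1 := by cases s <;> simp [boolSign]

theorem abs_boolSign_mul_le (hε : 0 ≤ ε) (s : Bool) (u : Fin n → ℝ) (k : Fin n) :
    |ε * boolSign s * u k| ≤ ε * ‖u‖ := by
  rw [abs_mul, abs_mul, abs_boolSign, abs_of_nonneg hε, mul_one]
  exact mul_le_mul_of_nonneg_left (norm_le_pi_norm u k) hε

/-- For small `ε`, any `m` of the normal vectors of pairwise non-parallel facets have linearly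
independent restrictions to the first `m` coordinates. -/
theorem eventually_eq_zero_of_cubeRow_eq_zero (n m : ℕ) : ∀ᶠ ε in 𝓝[>] (0 : ℝ),
    ∀ (K : Finset (Fin n)) (s : Fin n → Bool), m ≤ K.card → ∀ u : Fin n → ℝ,
      (∀ i : Fin n, m ≤ i → u i = 0) → (∀ k ∈ K, cubeRow n ε (k, s k) u = 0) → u = 0 := by
  have h1 : ∀ᶠ ε in 𝓝[>] (0 : ℝ), ∀ T ∈ (Finset.range n).powerset, m ≤ T.card →
      ∀ u : Fin n → ℝ, (∀ i : Fin n, m ≤ i → u i = 0) →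
        (∀ t ∈ T, |chooseEval u t| ≤ ε * ‖u‖) → u = 0 := by
    refine (Filter.eventually_all_finset _).2 fun T _ => ?_
    by_cases hT : m ≤ T.card
    · obtain ⟨δ, hδ, h⟩ := exists_mul_norm_le_of_chooseEval_le n hT
      filter_upwards [(gt_mem_nhds hδ).filter_mono nhdsWithin_le_nhds, self_mem_nhdsWithin]
        with ε hεδ hε0 _ u hu hut
      replace hε0 : 0 < ε := hε0
      have h2 := h u hu _ (mul_nonneg hε0.le (norm_nonneg u)) hut
      by_contra hne
      have h3 := mul_lt_mul_of_pos_right hεδ (norm_pos_iff.2 hne)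
      linarith
    · exact Eventually.of_forall fun ε h => absurd h hT
  filter_upwards [h1, self_mem_nhdsWithin] with ε h hε0 K s hK u hu hrow
  replace hε0 : 0 < ε := hε0
  have hex : ∃ a, ∀ h : a < n, (⟨a, h⟩ : Fin n) ∉ K := ⟨n, fun h => absurd h (lt_irrefl n)⟩
  classical
  -- `a` is the first index missing from `K`. Below it the rows form a triangular system, which
  -- gives `u k = 0` for `k < a` and so makes the polynomial vanish at every `t < a`.
  set a := Nat.find hex with ha
  have hlt : ∀ k : Fin n, (k : ℕ) < a → k ∈ K := fun k hk => by
    have := Nat.find_min hex hk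
    push Not at this
    exact this.2
  have hne : ∀ k ∈ K, (k : ℕ) ≠ a := fun k hk hka => by
    have h2 := Nat.find_spec hex
    rw [← ha, ← hka] at h2
    exact h2 k.2 hk
  have hzero : ∀ k : Fin n, (k : ℕ) < a → u k = 0 := by
    intro k
    induction k using WellFoundedLT.induction with
    | _ k ih =>
    intro hk
    have h2 := hrow k (hlt k hk)
    have h3 : chooseSum u k = 0 := Finset.sum_eq_zero fun j hj => by
      have hjk := Finset.mem_Iio.1 hj
      rw [ih j hjk ((Fin.lt_def.1 hjk).trans hk), mul_zero]
    rw [cubeRow_apply, h3, mul_zero, add_zero] at h2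
    have h4 : boolSign (s k) ≠ 0 := fun h => by have := abs_boolSign (s k); simp [h] at this
    exact (mul_eq_zero.1 h2).resolve_left (mul_ne_zero hε0.ne' h4)
  -- Row `k > a` controls the value at `k - 1 ≥ a`, row `k < a` is assigned the node `k`. As `a ∉
  -- K`, these nodes are distinct, and there are at least `m` of them.
  let ν : Fin n → ℕ := fun k => if (k : ℕ) < a then k else k - 1
  have hν : InjOn ν K := by
    intro k hk l hl hkl
    have h2 := hne k hk
    have h3 := hne l hl
    ext
    dsimp only [ν] at hkl
    split_ifs at hkl <;> omega
  refine h (K.image ν) ?_ ?_ u hu fun t ht => ?_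
  · refine Finset.mem_powerset.2 fun t ht => ?_
    obtain ⟨k, -, rfl⟩ := Finset.mem_image.1 ht
    rw [Finset.mem_range]
    dsimp only [ν]
    split_ifs <;> omega
  · rwa [Finset.card_image_of_injOn hν]
  · obtain ⟨k, hk, rfl⟩ := Finset.mem_image.1 ht
    have h2 := hne k hk
    dsimp only [ν]
    split_ifs with hka
    · rw [chooseEval_eq_zero_of_forall_le fun j hj => hzero j (by omega), abs_zero]
      positivity
    · rw [← chooseSum_eq_chooseEval u (by omega)]
      have h3 := hrow k hk
      rw [cubeRow_apply] at h3
      have h4 : |(-1) ^ ((k : ℕ) + 1) * chooseSum u k| = |chooseSum u k| := by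
        rw [abs_mul, abs_pow, abs_neg, abs_one, one_pow, one_mul]
      rw [← h4, eq_neg_of_add_eq_zero_right h3, abs_neg]
      exact abs_boolSign_mul_le hε0.le _ u k

/-- The coefficients of a linear relation between the values of a polynomial of small degree, which
involves only the points outside of a given set. -/
noncomputable def relationWeight (n : ℕ) (Z : Finset (Fin n)) (t : ℕ) : ℝ :=
  ((n - 2).choose t : ℝ) * ∏ z ∈ Z, ((t + 1 : ℕ) - (z : ℕ) : ℝ) ^ 2

theorem relationWeight_nonneg (Z : Finset (Fin n)) (t : ℕ) : 0 ≤ relationWeight n Z t :=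
  mul_nonneg (Nat.cast_nonneg _) (Finset.prod_nonneg fun _ _ => sq_nonneg _)

theorem relationWeight_eq_zero {Z : Finset (Fin n)} {t : ℕ} {z : Fin n} (hz : z ∈ Z)
    (hzt : (z : ℕ) = t + 1) : relationWeight n Z t = 0 := by
  rw [relationWeight, Finset.prod_eq_zero hz (by rw [hzt, sub_self]; simp), mul_zero]

theorem one_le_relationWeight {Z : Finset (Fin n)} {t : ℕ} (ht : t + 1 < n)
    (hZ : ∀ z ∈ Z, (z : ℕ) ≠ t + 1) : 1 ≤ relationWeight n Z t := by
  have h1 : (1 : ℝ) ≤ ((n - 2).choose t : ℝ) :=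
    Nat.one_le_cast.2 (Nat.choose_pos (by omega))
  refine one_le_mul_of_one_le_of_one_le h1 (Finset.prod_induction _ (1 ≤ ·)
    (fun _ _ => one_le_mul_of_one_le_of_one_le) le_rfl fun z hz => ?_)
  have h2 : (1 : ℤ) ≤ (((t + 1 : ℕ) : ℤ) - (z : ℕ)) ^ 2 := by
    have h3 : ((t + 1 : ℕ) : ℤ) - (z : ℕ) ≠ 0 := sub_ne_zero.2 (by exact_mod_cast (hZ z hz).symm)
    have := sq_pos_of_ne_zero h3
    omega
  exact_mod_cast h2

/-- Up to sign, this is the `(n - 2)`-th finite difference at 0 of `p(t) ∏ (t + 1 - z)^2`, whose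
degree is at most `2 |Z| + m - 1 < n - 2`. The squares remove the nodes `z - 1` while keeping the
weights nonnegative. -/
theorem sum_relationWeight_mul_chooseEval {Z : Finset (Fin n)} (hZ : 2 * Z.card + m + 2 ≤ n)
    (hm : 0 < m) {u : Fin n → ℝ} (hu : ∀ i : Fin n, m ≤ i → u i = 0) :
    ∑ t ∈ Finset.range (n - 1), relationWeight n Z t * ((-1) ^ t * chooseEval u t) = 0 := by
  let Q : ℝ[X] := (∏ z ∈ Z, (X + C (1 - ((z : ℕ) : ℝ))) ^ 2) * choosePoly u
  have hQ : Q.natDegree < n - 2 := by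
    have h1 := natDegree_choosePoly_lt hu hm
    have h2 : (∏ z ∈ Z, (X + C (1 - ((z : ℕ) : ℝ))) ^ 2).natDegree ≤ Z.card * 2 := by
      refine (natDegree_prod_le _ _).trans (Finset.sum_le_card_nsmul _ _ 2 fun z _ => ?_)
      refine natDegree_pow_le.trans ?_
      rw [natDegree_X_add_C]
    have h3 := natDegree_mul_le (p := ∏ z ∈ Z, (X + C (1 - ((z : ℕ) : ℝ))) ^ 2)
      (q := choosePoly u)
    change (_ * _ : ℝ[X]).natDegree < _
    omega
  have h := congrFun (Polynomial.fwdDiff_iter_eq_zero_of_degree_lt hQ) 0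
  rw [fwdDiff_iter_eq_sum_shift, Pi.zero_apply, show n - 2 + 1 = n - 1 by omega] at h
  rw [← mul_zero ((-1 : ℝ) ^ (n - 2)), ← h, Finset.mul_sum]
  refine Finset.sum_congr rfl fun t ht => ?_
  have ht' := Finset.mem_range.1 ht
  have hs : (-1 : ℝ) ^ (n - 2) * (-1) ^ (n - 2 - t) = (-1) ^ t := by
    rw [show n - 2 = t + (n - 2 - t) by omega, Nat.add_sub_cancel_left, pow_add, mul_assoc,
      ← mul_pow]
    norm_num
  have hev : Q.eval (0 + t • (1 : ℝ)) =
      (∏ z ∈ Z, ((t + 1 : ℕ) - (z : ℕ) : ℝ) ^ 2) * chooseEval u t := by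
    rw [zero_add, nsmul_one, eval_mul, eval_choosePoly, eval_prod]
    congr 1
    refine Finset.prod_congr rfl fun z _ => ?_
    simp
    ring
  rw [hev, ← hs, relationWeight, zsmul_eq_mul]
  push_cast
  ring

/-- For small `ε`, the restrictions to the first `m` coordinates of the normal vectors of the facets
containing a given face of small dimension have a nonnegative linear relation. -/
theorem eventually_not_cubeRow_neg {n m r : ℕ} (h : 2 * r + m + 2 ≤ n) : ∀ᶠ ε in 𝓝[>] (0 : ℝ),
    ∀ (Z : Finset (Fin n)) (s : Fin n → Bool), Z.card ≤ r → ∀ u : Fin n → ℝ,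
      (∀ i : Fin n, m ≤ i → u i = 0) → ¬ ∀ k ∉ Z, cubeRow n ε (k, s k) u < 0 := by
  refine eventually_all.2 fun Z => ?_
  by_cases hZ : Z.card ≤ r
  swap
  · exact Eventually.of_forall fun ε s h => absurd h hZ
  -- Nodes `t` whose row `t + 1` is outside `Z`. For `z = 0` truncated subtraction needlessly drops
  -- node 0, but at least `n - 1 - r ≥ m` nodes remain.
  let T : Finset ℕ := (Finset.range (n - 1)) \ Z.image fun z : Fin n => (z : ℕ) - 1
  have hT : m ≤ T.card := by
    have h1 := Finset.le_card_sdiff (Z.image fun z : Fin n => (z : ℕ) - 1) (Finset.range (n - 1))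
    have h2 := Finset.card_image_le (s := Z) (f := fun z : Fin n => (z : ℕ) - 1)
    rw [Finset.card_range] at h1
    change _ ≤ T.card at h1
    omega
  have hTm : ∀ t ∈ T, t + 1 < n ∧ ∀ z ∈ Z, (z : ℕ) ≠ t + 1 := by
    intro t ht
    obtain ⟨h1, h2⟩ := Finset.mem_sdiff.1 ht
    rw [Finset.mem_range] at h1
    refine ⟨by omega, fun z hz hzt => h2 (Finset.mem_image.2 ⟨z, hz, by omega⟩)⟩
  obtain ⟨δ, hδ, hδT⟩ := exists_mul_norm_le_of_chooseEval_le n hT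
  let Λ := ∑ t ∈ Finset.range (n - 1), relationWeight n Z t
  have hΛ0 : 0 ≤ Λ := Finset.sum_nonneg fun t _ => relationWeight_nonneg Z t
  have hev : ∀ᶠ ε in 𝓝[>] (0 : ℝ), ε * Λ < δ := by
    have ht : Tendsto (fun ε : ℝ => ε * Λ) (𝓝 0) (𝓝 (0 * Λ)) :=
      Continuous.tendsto (by fun_prop) 0
    rw [zero_mul] at ht
    exact (ht.eventually (gt_mem_nhds hδ)).filter_mono nhdsWithin_le_nhds
  filter_upwards [hev, self_mem_nhdsWithin] with ε hε hε0 s _ u hu hrow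
  replace hε0 : 0 < ε := hε0
  have hune : u ≠ 0 := by
    rintro rfl
    obtain ⟨k, hk⟩ : ∃ k, k ∉ Z := by
      by_contra hc
      push Not at hc
      rw [Finset.eq_univ_of_forall hc, Finset.card_univ, Fintype.card_fin] at hZ
      omega
    simpa using hrow k hk
  have hm : 0 < m := Nat.pos_of_ne_zero fun hm =>
    hune (funext fun i => hu i (by omega))
  have hM := norm_pos_iff.2 hune
  have hsum := sum_relationWeight_mul_chooseEval (m := m) (Z := Z) (by omega) hm hu
  have hup : ∀ t, t + 1 < n → (∀ z ∈ Z, (z : ℕ) ≠ t + 1) →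
      (-1) ^ t * chooseEval u t ≤ ε * ‖u‖ := by
    intro t htn htZ
    have h1 := hrow ⟨t + 1, htn⟩ fun hz => htZ _ hz rfl
    rw [cubeRow_apply, chooseSum_eq_chooseEval u (Nat.succ_pos t)] at h1
    have h2 := neg_abs_le (ε * boolSign (s ⟨t + 1, htn⟩) * u ⟨t + 1, htn⟩)
    have h3 := abs_boolSign_mul_le hε0.le (s ⟨t + 1, htn⟩) u ⟨t + 1, htn⟩
    have h4 : (-1 : ℝ) ^ (t + 1 + 1) = (-1) ^ t := by rw [pow_add, pow_add]; norm_num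
    simp only [Nat.add_sub_cancel, h4] at h1
    linarith
  have hterm : ∀ t ∈ Finset.range (n - 1), relationWeight n Z t * ((-1) ^ t * chooseEval u t) ≤
      relationWeight n Z t * (ε * ‖u‖) := by
    intro t ht
    rw [Finset.mem_range] at ht
    by_cases hz : ∀ z ∈ Z, (z : ℕ) ≠ t + 1
    · exact mul_le_mul_of_nonneg_left (hup t (by omega) hz) (relationWeight_nonneg Z t)
    · push Not at hz
      obtain ⟨z, hz, hzt⟩ := hz
      rw [relationWeight_eq_zero hz hzt, zero_mul, zero_mul]
  -- The weighted sum is zero and each term is at most its weight times `ε ‖u‖`, so no term can be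
  -- very negative. As the weights on `T` are at least 1, all values there are of order `ε ‖u‖`,
  -- which contradicts `hδT` for small `ε`.
  have hle : ∀ t ∈ T, |chooseEval u t| ≤ ε * Λ * ‖u‖ := by
    intro t ht
    obtain ⟨htn, htZ⟩ := hTm t ht
    have htr : t ∈ Finset.range (n - 1) := Finset.mem_range.2 (by omega)
    have hw := one_le_relationWeight htn htZ
    have hwΛ : relationWeight n Z t ≤ Λ :=
      Finset.single_le_sum (fun t _ => relationWeight_nonneg Z t) htr
    have hεM : 0 ≤ ε * ‖u‖ := mul_nonneg hε0.le hM.le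
    have e0 : |chooseEval u t| = |(-1) ^ t * chooseEval u t| := by
      rw [abs_mul, abs_pow, abs_neg, abs_one, one_pow, one_mul]
    have e1 := hup t htn htZ
    have e2 : 0 ≤ relationWeight n Z t * ((-1) ^ t * chooseEval u t) +
        (Λ - relationWeight n Z t) * (ε * ‖u‖) := by
      have h1 := Finset.sum_le_sum fun t' (ht' : t' ∈ (Finset.range (n - 1)).erase t) =>
        hterm t' (Finset.mem_of_mem_erase ht')
      rw [← Finset.sum_mul] at h1
      have h2 := Finset.add_sum_erase _ (fun t => relationWeight n Z t) htr
      have h3 := Finset.add_sum_erase _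
        (fun t => relationWeight n Z t * ((-1) ^ t * chooseEval u t)) htr
      rw [hsum] at h3
      have h4 : Λ - relationWeight n Z t =
          ∑ t ∈ (Finset.range (n - 1)).erase t, relationWeight n Z t := by
        change ∑ t ∈ Finset.range (n - 1), relationWeight n Z t - _ = _
        rw [← h2]; ring
      rw [h4]
      linarith
    rw [e0, mul_right_comm, abs_le]
    have e3 : ε * ‖u‖ ≤ ε * ‖u‖ * Λ := le_mul_of_one_le_right hεM (hw.trans hwΛ)
    refine ⟨?_, e1.trans e3⟩
    by_contra hc
    push Not at hc
    have e4 : (-1) ^ t * chooseEval u t < 0 := hc.trans_le (by nlinarith)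
    have e5 : relationWeight n Z t * ((-1) ^ t * chooseEval u t) ≤ (-1) ^ t * chooseEval u t := by
      nlinarith
    have e6 : 0 ≤ relationWeight n Z t * (ε * ‖u‖) := mul_nonneg (by linarith) hεM
    nlinarith
  have h1 := hδT u hu _ (by positivity) hle
  have h2 := mul_lt_mul_of_pos_right hε hM
  linarith

end ChooseEval

/-! ### Genericity and boundary criterion for the projected cubes -/

section Projection

open Set Filter Topology

variable {d n m : ℕ} {ε : ℝ}

/-- The projection to the last `d` coordinates as a continuous linear map. -/
noncomputable def lastCoordsL (h : d ≤ n) : (Fin n → ℝ) →L[ℝ] (Fin d → ℝ) :=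
  ContinuousLinearMap.pi fun i => ContinuousLinearMap.proj ⟨n - d + i, by omega⟩

theorem coe_lastCoordsL (h : d ≤ n) : ⇑(lastCoordsL h) = lastCoords h := rfl

theorem lastCoordsL_eq_zero_iff (h : d ≤ n) {u : Fin n → ℝ} :
    lastCoordsL h u = 0 ↔ ∀ i : Fin n, n - d ≤ i → u i = 0 := by
  constructor
  · intro hu i hi
    have h1 := congrFun hu ⟨i - (n - d), by omega⟩
    change u ⟨n - d + (i - (n - d)), _⟩ = 0 at h1
    rwa [show (⟨n - d + (i - (n - d)), by omega⟩ : Fin n) = i from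
      Fin.ext (Nat.add_sub_of_le hi)] at h1
  · intro hu
    funext i
    exact hu _ (Nat.le_add_right _ _)

theorem surjective_lastCoordsL (h : d ≤ n) : Function.Surjective (lastCoordsL h) := by
  intro y
  refine ⟨fun i => if hi : n - d ≤ i then y ⟨i - (n - d), by omega⟩ else 0, ?_⟩
  funext i
  change (if hi : n - d ≤ n - d + i then y ⟨n - d + i - (n - d), by omega⟩ else 0) = y i
  rw [dif_pos (Nat.le_add_right _ _)]
  congr 1
  exact Fin.ext (Nat.add_sub_cancel_left _ _)

/-- The first one of the last `d + 1` coordinates. -/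
noncomputable def heightCoord (h : d + 1 ≤ n) : StrongDual ℝ (Fin n → ℝ) :=
  ContinuousLinearMap.proj ⟨n - (d + 1), by omega⟩

theorem lastCoords_succ_zero (h : d + 1 ≤ n) (x : Fin n → ℝ) :
    lastCoords h x 0 = heightCoord h x := rfl

theorem dropFirst_lastCoords (h : d + 1 ≤ n) (hn : d ≤ n) (x : Fin n → ℝ) :
    dropFirst (lastCoords h x) = lastCoordsL hn x := by
  funext i
  change x ⟨n - (d + 1) + (i + 1), _⟩ = x ⟨n - d + i, _⟩
  congr 1
  exact Fin.ext (by simp only; omega)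

theorem heightCoord_prod_eq_zero_iff (h : d + 1 ≤ n) (hn : d ≤ n) {u : Fin n → ℝ} :
    (heightCoord h).prod (lastCoordsL hn) u = 0 ↔
      ∀ i : Fin n, n - (d + 1) ≤ i → u i = 0 := by
  rw [← lastCoordsL_eq_zero_iff h, coe_lastCoordsL, ContinuousLinearMap.prod_apply,
    Prod.mk_eq_zero, ← dropFirst_lastCoords h hn, ← lastCoords_succ_zero, funext_iff, funext_iff]
  exact (Fin.forall_fin_succ (P := fun i => lastCoords h u i = 0)).symm

theorem surjective_heightCoord_prod (h : d + 1 ≤ n) (hn : d ≤ n) :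
    Function.Surjective ((heightCoord h).prod (lastCoordsL hn)) := by
  rintro ⟨t, y⟩
  obtain ⟨x, hx⟩ := surjective_lastCoordsL h (Fin.cons t y)
  rw [coe_lastCoordsL] at hx
  refine ⟨x, ?_⟩
  rw [ContinuousLinearMap.prod_apply, ← dropFirst_lastCoords h hn, ← lastCoords_succ_zero, hx]
  rfl

theorem cubicalPoly_eq_image (h : d ≤ n) (hε : 0 < ε) :
    cubicalPoly h ε =
      lastCoordsL h '' polyhedron (cubeRow n ε) (fun i => cubeBound ε i.1) := by
  rw [cubicalPoly, deformedCube_eq_polyhedron hε, coe_lastCoordsL]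

/-- A normal vector with positive first entry can be scaled to first entry 1; the remaining entries
are then the functional `l`. -/
theorem image_upper_eq (h : d + 1 ≤ n) (hn : d ≤ n) {P : Set (Fin n → ℝ)} {c : Fin (d + 1) → ℝ}
    (hc : 0 < c 0) {l : StrongDual ℝ (Fin d → ℝ)} (hl : ∀ y, c 0 * l y = ∑ i, c i.succ * y i) :
    dropFirst '' {y ∈ lastCoords h '' P | ∀ z ∈ lastCoords h '' P, c ⬝ᵥ z ≤ c ⬝ᵥ y} =
      lastCoordsL hn '' (heightCoord h + l.comp (lastCoordsL hn)).toExposed P := by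
  have key : ∀ x, c ⬝ᵥ lastCoords h x =
      c 0 * (heightCoord h + l.comp (lastCoordsL hn)) x := by
    intro x
    rw [dotProduct, Fin.sum_univ_succ, _root_.add_apply, ContinuousLinearMap.comp_apply, mul_add,
      hl, ← dropFirst_lastCoords h hn]
    rfl
  refine Subset.antisymm ?_ ?_
  · rintro _ ⟨_, ⟨⟨x, hx, rfl⟩, hm⟩, rfl⟩
    refine ⟨x, ⟨hx, fun z hz => ?_⟩, (dropFirst_lastCoords h hn x).symm⟩
    have h1 := hm _ (mem_image_of_mem _ hz)
    rw [key, key] at h1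
    exact le_of_mul_le_mul_left h1 hc
  · rintro _ ⟨x, hx, rfl⟩
    refine ⟨_, ⟨mem_image_of_mem _ hx.1, ?_⟩, dropFirst_lastCoords h hn x⟩
    rintro _ ⟨z, hz, rfl⟩
    rw [key, key]
    exact mul_le_mul_of_nonneg_left (hx.2 z hz) hc.le

theorem upperProjection_image (h : d + 1 ≤ n) (hn : d ≤ n) (P : Set (Fin n → ℝ)) :
    upperProjection (lastCoords h '' P) = upperCells P (heightCoord h) (lastCoordsL hn) := by
  refine Subset.antisymm ?_ ?_
  · rintro _ ⟨_, ⟨c, hc, rfl⟩, rfl⟩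
    refine ⟨(c 0)⁻¹ • ∑ i, c (Fin.succ i) • ContinuousLinearMap.proj i,
      image_upper_eq h hn hc fun y => ?_⟩
    simp [hc.ne']
  · rintro _ ⟨l, rfl⟩
    refine ⟨_, ⟨Fin.cons 1 fun i => l (Pi.single i 1), by simp, rfl⟩,
      (image_upper_eq h hn (by simp) fun y => ?_).symm⟩
    simp only [Fin.cons_zero, Fin.cons_succ, one_mul]
    conv_lhs => rw [pi_eq_sum_univ' y]
    rw [map_sum]
    refine Finset.sum_congr rfl fun i _ => ?_
    rw [map_smul, smul_eq_mul, mul_comm]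

/-- The indices of the facets containing a point of the deformed cube, up to sign. -/
theorem exists_finset_tight (hε : 0 < ε) (hT : IsTame n ε) {x : Fin n → ℝ}
    (hx : x ∈ polyhedron (cubeRow n ε) (fun i => cubeBound ε i.1)) :
    ∃ (K : Finset (Fin n)) (s : Fin n → Bool),
      K.card = (tight (cubeRow n ε) (fun i => cubeBound ε i.1) x).ncard ∧
      ∀ i, i ∈ tight (cubeRow n ε) (fun i => cubeBound ε i.1) x ↔ i.1 ∈ K ∧ i.2 = s i.1 := by
  classical
  have hc := isConsistent_tight hε hT hx
  set I := tight (cubeRow n ε) (fun i => cubeBound ε i.1) x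
  let s : Fin n → Bool := fun k => decide ((k, true) ∈ I)
  let K : Finset (Fin n) := Finset.univ.filter fun k => (k, s k) ∈ I
  have hmem : ∀ i, i ∈ I ↔ i.1 ∈ K ∧ i.2 = s i.1 := by
    rintro ⟨k, b⟩
    have h1 := hc k
    by_cases h2 : (k, true) ∈ I <;> by_cases h3 : (k, false) ∈ I <;> cases b <;>
      simp [K, s, h2, h3] at h1 ⊢
  refine ⟨K, s, ?_, hmem⟩
  have hI : I = ((K.image fun k => (k, s k) : Finset (Fin n × Bool)) : Set (Fin n × Bool)) := by
    ext ⟨k, b⟩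
    rw [hmem]
    simp only [Finset.coe_image, mem_image, SetLike.mem_coe, Prod.mk.injEq]
    constructor
    · rintro ⟨h1, h2⟩
      exact ⟨k, h1, rfl, h2.symm⟩
    · rintro ⟨k', h1, rfl, h2⟩
      exact ⟨h1, h2.symm⟩
  rw [hI, Set.ncard_coe_finset, Finset.card_image_of_injective _ fun k l h => congrArg Prod.fst h]

/-- The kernel has dimension `m`. At least `m` tight rows determine a kernel vector; at most `m` are
independent on the kernel and can be given the value -1 simultaneously. -/
theorem isGenericProjection_cube {E' : Type*} [NormedAddCommGroup E'] [NormedSpace ℝ E']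
    (hε : 0 < ε) (hT : IsTame n ε) (hm : m ≤ n) {f : (Fin n → ℝ) →L[ℝ] E'}
    (hf : ∀ u, f u = 0 ↔ ∀ i : Fin n, m ≤ i → u i = 0)
    (hgen : ∀ (K : Finset (Fin n)) (s : Fin n → Bool), m ≤ K.card → ∀ u : Fin n → ℝ,
      (∀ i : Fin n, m ≤ i → u i = 0) → (∀ k ∈ K, cubeRow n ε (k, s k) u = 0) → u = 0) :
    IsGenericProjection (cubeRow n ε) (fun i => cubeBound ε i.1) f := by
  intro x hx
  obtain ⟨K, s, -, hK⟩ := exists_finset_tight hε hT hx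
  rcases le_total m K.card with hmK | hmK
  · exact Or.inr fun u hu hxu => hgen K s hmK u ((hf u).1 hu) fun k hk =>
      hxu _ ((hK (k, s k)).2 ⟨hk, rfl⟩)
  · left
    -- Padding `K` to exactly `m` indices makes `L`, which collects these rows and the last
    -- coordinates, a square system; it is injective by `hgen`, hence surjective.
    obtain ⟨K', hKK', hK'⟩ := Finset.exists_superset_card_eq hmK (by simpa using hm)
    let L : (Fin n → ℝ) →ₗ[ℝ] (K' ⊕ {i : Fin n // m ≤ i} → ℝ) := LinearMap.pi
      (Sum.elim (fun k => (cubeRow n ε (k.1, s k.1)).toLinearMap) fun i => LinearMap.proj i.1)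
    have hinj : Function.Injective L := LinearMap.ker_eq_bot.1 (LinearMap.ker_eq_bot'.2 fun u hu =>
      hgen K' s hK'.ge u (fun i hi => congrFun hu (Sum.inr ⟨i, hi⟩))
        fun k hk => congrFun hu (Sum.inl ⟨k, hk⟩))
    have hcard : Fintype.card {i : Fin n // m ≤ i} = n - m := by
      rw [Fintype.card_subtype]
      have h1 := Finset.card_filter_add_card_filter_not (s := (Finset.univ : Finset (Fin n)))
        (fun i => (i : ℕ) < m)
      rw [Fin.card_filter_val_lt, Finset.card_univ, Fintype.card_fin, min_eq_right hm] at h1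
      simp only [not_lt] at h1
      omega
    have hsurj : Function.Surjective L := by
      refine (LinearMap.injective_iff_surjective_of_finrank_eq_finrank ?_).1 hinj
      rw [Module.finrank_fintype_fun_eq_card, Module.finrank_fintype_fun_eq_card, Fintype.card_sum,
        Fintype.card_coe, hK', hcard, Fintype.card_fin]
      omega
    obtain ⟨u, hu⟩ := hsurj (Sum.elim (fun _ => -1) fun _ => 0)
    refine ⟨u, (hf u).2 fun i hi => congrFun hu (Sum.inr ⟨i, hi⟩), ?_⟩
    rintro ⟨k, b⟩ hi
    obtain ⟨h1, h3⟩ := (hK _).1 hi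
    have h2 : cubeRow n ε (k, s k) u = -1 := congrFun hu (Sum.inl ⟨k, hKK' h1⟩)
    rw [show b = s k from h3, h2]
    norm_num

theorem not_exists_neg_on_tight {r : ℕ} {E' : Type*} [NormedAddCommGroup E'] [NormedSpace ℝ E']
    (hε : 0 < ε) (hT : IsTame n ε) {f : (Fin n → ℝ) →L[ℝ] E'}
    (hf : ∀ u, f u = 0 ↔ ∀ i : Fin n, m ≤ i → u i = 0)
    (hneg : ∀ (Z : Finset (Fin n)) (s : Fin n → Bool), Z.card ≤ r → ∀ u : Fin n → ℝ,
      (∀ i : Fin n, m ≤ i → u i = 0) → ¬ ∀ k ∉ Z, cubeRow n ε (k, s k) u < 0) {x : Fin n → ℝ}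
    (hx : x ∈ polyhedron (cubeRow n ε) (fun i => cubeBound ε i.1))
    (hr : Module.finrank ℝ (Fin n → ℝ) ≤
      r + (tight (cubeRow n ε) (fun i => cubeBound ε i.1) x).ncard) :
    ¬ ∃ u, f u = 0 ∧
      ∀ i ∈ tight (cubeRow n ε) (fun i => cubeBound ε i.1) x, cubeRow n ε i u < 0 := by
  rintro ⟨u, hu, hxu⟩
  obtain ⟨K, s, hKc, hK⟩ := exists_finset_tight hε hT hx
  rw [Module.finrank_fin_fun, ← hKc] at hr
  refine hneg Kᶜ s ?_ u ((hf u).1 hu) fun k hk => hxu _ ((hK (k, s k)).2 ⟨by simpa using hk, rfl⟩)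
  rw [Finset.card_compl, Fintype.card_fin]
  omega

end Projection

theorem mainTheorem8 (d n : ℕ) (hd : 2 ≤ d) (hn : d ≤ n) :
    ∃ ε₀ : ℝ, 0 < ε₀ ∧ ∀ ε : ℝ, 0 < ε → ε < ε₀ →
      (∀ h : d + 1 ≤ n,
        IsCubicalSubdivision (upperProjection (cubicalPoly h ε)) (cubicalPoly hn ε) ∧
        ∀ F ∈ upperProjection (cubicalPoly h ε),
          polyDim F = d / 2 - 1 → ¬ IsInteriorCell (cubicalPoly hn ε) F) ∧
      IsStacked ((d + 1) / 2) (cubicalPoly hn ε) := by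
  -- Genericity is needed for the projections to `ℝ^d` and to `ℝ^(d+1)`, with kernels of dimension
  -- `n - d` and `n - (d + 1)`. For the last condition, `2 (⌊d/2⌋ - 1) + (n - d) + 2 ≤ n`.
  have hev := (eventually_isTame n).and ((eventually_eq_zero_of_cubeRow_eq_zero n (n - d)).and
    ((eventually_eq_zero_of_cubeRow_eq_zero n (n - (d + 1))).and
      (eventually_not_cubeRow_neg (n := n) (m := n - d) (r := d / 2 - 1) (by omega))))
  obtain ⟨ε₀, hε₀, hsub⟩ := mem_nhdsGT_iff_exists_Ioo_subset.1 hev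
  refine ⟨ε₀, hε₀, fun ε hε hεε₀ => ?_⟩
  obtain ⟨hT, hgen, hgen', hneg⟩ := hsub ⟨hε, hεε₀⟩
  have hP := isCompact_deformedCube hε hT
  rw [deformedCube_eq_polyhedron hε] at hP
  obtain ⟨z, hz⟩ := exists_forall_cubeRow_lt (n := n) hε hT
  have hcube := fun x hx => isCombinatorialCube_tightFace (n := n) (x := x) hε hT hx
  have hG := isGenericProjection_cube hε hT (Nat.sub_le n d)
    (fun u => lastCoordsL_eq_zero_iff hn (u := u)) hgen
  have hpoly : IsCubicalPolytope d (cubicalPoly hn ε) := by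
    have h1 := isCubicalPolytope_image (surjective_lastCoordsL hn) hG hP hz hcube
    rwa [Module.finrank_fin_fun, ← cubicalPoly_eq_image hn hε] at h1
  have hupper : ∀ h : d + 1 ≤ n,
      IsCubicalSubdivision (upperProjection (cubicalPoly h ε)) (cubicalPoly hn ε) ∧
      ∀ F ∈ upperProjection (cubicalPoly h ε),
        polyDim F = d / 2 - 1 → ¬ IsInteriorCell (cubicalPoly hn ε) F := by
    intro h
    have hG' := isGenericProjection_cube hε hT (Nat.sub_le n (d + 1))
      (fun u => heightCoord_prod_eq_zero_iff h hn (u := u)) hgen'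
    have hs := surjective_heightCoord_prod h hn
    rw [cubicalPoly_eq_image h hε, coe_lastCoordsL, upperProjection_image h hn,
      cubicalPoly_eq_image hn hε]
    refine ⟨isCubicalSubdivision_upperCells hs hG' hG hP hz hcube, fun F hF hFr => ?_⟩
    exact not_not.2 (subset_frontier_of_mem_upperCells hs hG' hP hz (fun x hx hr =>
      not_exists_neg_on_tight hε hT (fun u => lastCoordsL_eq_zero_iff hn (u := u)) hneg hx hr)
      hF hFr)
  refine ⟨hupper, hpoly, ?_⟩
  rcases hn.eq_or_lt with rfl | hlt
  -- For `n = d` the polytope is itself a combinatorial cube. In the subdivision by its own faces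
  -- the only interior cell is the polytope, which has dimension `d`.
  · refine ⟨{F | IsExposed ℝ (cubicalPoly hn ε) F ∧ F.Nonempty}, ?_, ?_⟩
    · rw [cubicalPoly_eq_image hn hε]
      exact isCubicalSubdivision_faces (fun u hu => funext fun i =>
        (lastCoordsL_eq_zero_iff hn).1 hu i (by omega)) ⟨z, fun i => (hz i).le⟩ hcube
    · rintro F ⟨hF, hFne⟩ hdim
      refine not_not.2 (IsProperFace.subset_frontier ⟨hF, hFne, ?_⟩)
      rintro rfl
      have := hpoly.2.1
      omega
  -- Here `d - ⌊(d+1)/2⌋ - 1 = ⌊d/2⌋ - 1`.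
  · exact ⟨_, (hupper hlt).1, fun F hF hdim => (hupper hlt).2 F hF (by omega)⟩
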